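/- Let $M$ be a compact oriented spin Riemannian manifold of dimension $n\ge 3$ (without boundary), with Levi-Civita connection $\nabla^L$ and scalar curvature $s$. Let $\Delta$ be a finite-dimensional complex representation of the Clifford algebra with generators $\varepsilon_1,\dots,\varepsilon_n$ and relations $\varepsilon_i\varepsilon_j+\varepsilon_j\varepsilon_i=-2\delta_{ij}$ (for irreducible $\Delta$, the spinor module), and let $S$ be the bundle with fibre $\Delta$ associated with the spin structure (the spinor bundle). Let $\{e_1,\dots,e_n\}$ be a local orthonormal frame of the spin structure, $c(e_i)$ the Clifford action (the constant endomorphism $\varepsilon_i$ in the corresponding spin frame of $S$), $c(X)=\sum_i g(X,e_i)c(e_i)$, and $\omega_{s,t}$ the connection forms, $\nabla^L e_t=\sum_s\omega_{s,t}e_s$. The spin connection and the Dirac operator are $$\nabla^S_X=X-\tfrac14\sum_{s,t}\omega_{s,t}(X)c(e_s)c(e_t),\qquad D=\sum_{i=1}^n c(e_i)\nabla^S_{e_i}.$$ Let $p$ be a smooth real $(0,2)$-tensor field on $M$, $p_{uv}=p(e_u,e_v)$, and let $f_1,f_2$ be smooth complex-valued functions on $M$ (for instance complex constants). Put $$P=\sum_{u<v}(p_{uv}-p_{vu})c(e_u)c(e_v),\qquad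 A=f_1P+f_2,\qquad B=-\overline{f_1}P+\overline{f_2},$$ $$\widetilde D=D+f_1P+f_2,\qquad \widetilde D^*=D-\overline{f_1}P+\overline{f_2}.$$ For a section $F$ of $\mathrm{End}(S)$ let $\nabla^S_XF$ denote its covariant derivative, $(\nabla^S_XF)\psi=\nabla^S_X(F\psi)-F\nabla^S_X\psi$. Let $\partial_i$ be the coordinate fields of an arbitrary local coordinate system, $g_{ij}=g(\partial_i,\partial_j)$ and $(g^{ij})=(g_{ij})^{-1}$. Then, as differential operators on smooth sections of $S$, $$\begin{aligned} \widetilde D^*\widetilde D={}&-\sum_{i,j}g^{ij}\big(\nabla_{\partial_i}\nabla_{\partial_j}-\nabla_{\nabla^L_{\partial_i}\partial_j}\big)+\tfrac14 s+(f_1\overline{f_2}-\overline{f_1}f_2)P+\tfrac14\sum_i\big[c(e_i)A+Bc(e_i)\big]^2\\ &+\tfrac12\sum_j\big[c(e_j)(\nabla^S_{e_j}A)-(\nabla^S_{e_j}B)c(e_j)\big]-f_1\overline{f_1}P^2+f_2\overline{f_2}, \end{aligned}$$ where $\nabla_X=\nabla^S_X-\tfrac12\big(c(X)A+Bc(X)\big)$,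 and $$\begin{aligned} \widetilde D^2={}&-\sum_{i,j}g^{ij}\big(\nabla_{\partial_i}\nabla_{\partial_j}-\nabla_{\nabla^L_{\partial_i}\partial_j}\big)+\tfrac14 s+f_1^2P^2+\tfrac14\sum_i\big[c(e_i)A+Ac(e_i)\big]^2\\ &-\tfrac12\sum_j\big[(\nabla^S_{e_j}A)c(e_j)-c(e_j)(\nabla^S_{e_j}A)\big]+2f_1f_2P+f_2^2, \end{aligned}$$ where now $\nabla_X=\nabla^S_X-\tfrac12\big(c(X)A+Ac(X)\big)$. -/

import Mathlib

open Bundle NormedSpace VectorField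
open scoped Manifold ContDiff Topology

set_option linter.unusedSectionVars false

namespace DiracWitten

noncomputable section

section LeviCivita

variable {E : Type*} [NormedAddCommGroup E] [NormedSpace ℝ E] [FiniteDimensional ℝ E]
  {H : Type*} [TopologicalSpace H] {I : ModelWithCorners ℝ E H}
  {M : Type*} [TopologicalSpace M] [ChartedSpace H M] [IsManifold I ∞ M]
  [RiemannianBundle (fun x : M => TangentSpace I x)]
  [IsContMDiffRiemannianBundle I ∞ E (fun x : M => TangentSpace I x)]

/-- The Koszul expression, equal to `g(∇_X Y, Z)` at `x`. -/
def koszul (Y X Z : Π x : M, TangentSpace I x) (x : M) : ℝ :=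
  (1 / 2 : ℝ) *
    (d% (fun y => inner ℝ (Y y) (Z y)) x (X x) + d% (fun y => inner ℝ (X y) (Z y)) x (Y x)
      - d% (fun y => inner ℝ (X y) (Y y)) x (Z x)
      + inner ℝ (mlieBracket I X Y x) (Z x) - inner ℝ (mlieBracket I X Z x) (Y x)
      - inner ℝ (mlieBracket I Y Z x) (X x))

theorem mdifferentiableAt_inner {X Y : Π x : M, TangentSpace I x} {x : M}
    (hX : MDiffAt (T% X) x) (hY : MDiffAt (T% Y) x) :
    MDiffAt (fun y => inner ℝ (X y) (Y y)) x :=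
  MDifferentiableAt.inner_bundle (E := fun x : M => TangentSpace I x) (F := E) (IB := I) (IM := I)
    (b := fun y => y) (v := X) (w := Y) hX hY

theorem koszul_tensorial_X {Y Z : Π x : M, TangentSpace I x} {x : M}
    (hY : MDiffAt (T% Y) x) (hZ : MDiffAt (T% Z) x) :
    TensorialAt I E (fun X => koszul (I := I) Y X Z x) x where
  smul {f X} hf hX := by
    have h1 := mvfderiv_fun_mul hf (mdifferentiableAt_inner hX hZ)
    have h2 := mvfderiv_fun_mul hf (mdifferentiableAt_inner hX hY)
    simp [koszul, mlieBracket_smul_left hf hX, inner_smul_left, inner_smul_right, inner_add_left,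
      h1, h2]
    simp only [real_inner_comm (X x)]
    ring
  add {X X'} hX hX' := by
    have h1 := mvfderiv_fun_add (mdifferentiableAt_inner hX hZ) (mdifferentiableAt_inner hX' hZ)
    have h2 := mvfderiv_fun_add (mdifferentiableAt_inner hX hY) (mdifferentiableAt_inner hX' hY)
    simp [koszul, mlieBracket_add_left hX hX', inner_add_left, inner_add_right, h1, h2]
    ring

theorem koszul_tensorial_Z {Y X : Π x : M, TangentSpace I x} {x : M}
    (hY : MDiffAt (T% Y) x) (hX : MDiffAt (T% X) x) :
    TensorialAt I E (fun Z => koszul (I := I) Y X Z x) x where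
  smul {f Z} hf hZ := by
    have h1 := mvfderiv_fun_mul hf (mdifferentiableAt_inner hY hZ)
    have h2 := mvfderiv_fun_mul hf (mdifferentiableAt_inner hX hZ)
    simp [koszul, mlieBracket_smul_right hf hZ, inner_smul_left, inner_smul_right, inner_add_left,
      h1, h2]
    simp only [real_inner_comm (X x), real_inner_comm (Y x) (Z x)]
    ring
  add {Z Z'} hZ hZ' := by
    have h1 := mvfderiv_fun_add (mdifferentiableAt_inner hY hZ) (mdifferentiableAt_inner hY hZ')
    have h2 := mvfderiv_fun_add (mdifferentiableAt_inner hX hZ) (mdifferentiableAt_inner hX hZ')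
    simp [koszul, mlieBracket_add_right hZ hZ', inner_add_left, inner_add_right, h1, h2]
    ring

open Classical in
/-- The Koszul expression as a bilinear form in `(X x, Z x)`, for `Y` differentiable at `x`
(and `0` otherwise). -/
def koszulForm (Y : Π x : M, TangentSpace I x) (x : M) :
    TangentSpace I x →L[ℝ] TangentSpace I x →L[ℝ] ℝ :=
  if hY : MDiffAt (T% Y) x then
    TensorialAt.mkHom₂ (fun X Z => koszul (I := I) Y X Z x) x
      (fun _ hZ => koszul_tensorial_X hY hZ) (fun _ hX => koszul_tensorial_Z hY hX)
  else 0

theorem koszulForm_apply {Y X Z : Π x : M, TangentSpace I x} {x : M}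
    (hY : MDiffAt (T% Y) x) (hX : MDiffAt (T% X) x) (hZ : MDiffAt (T% Z) x) :
    koszulForm (I := I) Y x (X x) (Z x) = koszul (I := I) Y X Z x := by
  rw [koszulForm, dif_pos hY]
  exact TensorialAt.mkHom₂_apply _ _ hX hZ


instance tangentSpace_finiteDimensional (x : M) : FiniteDimensional ℝ (TangentSpace I x) :=
  VectorBundle.finiteDimensional ℝ E (TangentSpace I : M → Type _) x

/-- The vector `∇_X Y (x)` as a linear function of `X x`: it is the vector representing the linear
form `Z ↦ koszul Y X Z x`. -/
def leviCivitaFun (Y : Π x : M, TangentSpace I x) (x : M) :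
    TangentSpace I x →L[ℝ] TangentSpace I x :=
  ∑ k, ((koszulForm Y x).flip (stdOrthonormalBasis ℝ (TangentSpace I x) k)).smulRight
    (stdOrthonormalBasis ℝ (TangentSpace I x) k)

theorem inner_leviCivitaFun (Y : Π x : M, TangentSpace I x) (x : M) (v w : TangentSpace I x) :
    inner ℝ (leviCivitaFun Y x v) w = koszulForm Y x v w := by
  conv_rhs => rw [← (stdOrthonormalBasis ℝ (TangentSpace I x)).sum_repr w]
  simp [leviCivitaFun, sum_inner, inner_smul_left, OrthonormalBasis.repr_apply_apply, mul_comm]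

theorem inner_leviCivitaFun_eq {Y X Z : Π x : M, TangentSpace I x} {x : M}
    (hY : MDiffAt (T% Y) x) (hX : MDiffAt (T% X) x) (hZ : MDiffAt (T% Z) x) :
    inner ℝ (leviCivitaFun Y x (X x)) (Z x) = koszul Y X Z x := by
  rw [inner_leviCivitaFun, koszulForm_apply hY hX hZ]

theorem tangent_clm_ext {x : M} {A B : TangentSpace I x →L[ℝ] TangentSpace I x}
    (h : ∀ X Z : Π x : M, TangentSpace I x, MDiffAt (T% X) x → MDiffAt (T% Z) x →
      (inner ℝ (A (X x)) (Z x) : ℝ) = inner ℝ (B (X x)) (Z x)) : A = B := by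
  ext v
  refine ext_inner_right ℝ fun w => ?_
  have := h (FiberBundle.extend E v) (FiberBundle.extend E w)
    (FiberBundle.mdifferentiableAt_extend ..) (FiberBundle.mdifferentiableAt_extend ..)
  simpa using this

theorem isCovariantDerivativeOn_leviCivitaFun :
    IsCovariantDerivativeOn E (leviCivitaFun (I := I) (M := M)) where
  add {Y Y' x} hY hY' _ := by
    refine tangent_clm_ext fun X Z hX hZ => ?_
    have hYY : MDiffAt (T% (Y + Y')) x := mdifferentiableAt_add_section hY hY'
    have h1 := mvfderiv_fun_add (mdifferentiableAt_inner hY hZ) (mdifferentiableAt_inner hY' hZ)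
    have h2 := mvfderiv_fun_add (mdifferentiableAt_inner hX hY) (mdifferentiableAt_inner hX hY')
    rw [inner_leviCivitaFun_eq hYY hX hZ, add_apply, inner_add_left,
      inner_leviCivitaFun_eq hY hX hZ, inner_leviCivitaFun_eq hY' hX hZ]
    simp [koszul, mlieBracket_add_right hY hY', mlieBracket_add_left hY hY', inner_add_left,
      inner_add_right, h1, h2]
    ring
  leibniz {Y f x} hY hf _ := by
    refine tangent_clm_ext fun X Z hX hZ => ?_
    have hfY : MDiffAt (T% (f • Y)) x := hf.smul_section hY
    have h1 := mvfderiv_fun_mul hf (mdifferentiableAt_inner hY hZ)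
    have h2 := mvfderiv_fun_mul hf (mdifferentiableAt_inner hX hY)
    rw [inner_leviCivitaFun_eq hfY hX hZ, add_apply, inner_add_left,
      smul_apply, inner_smul_left, inner_leviCivitaFun_eq hY hX hZ]
    simp [koszul, mlieBracket_smul_right hf hY, mlieBracket_smul_left hf hY, inner_smul_left,
      inner_smul_right, inner_add_left, h1, h2]
    simp only [real_inner_comm (X x)]
    ring

variable (I M) in
/-- The Levi-Civita connection of the Riemannian metric, given by the Koszul formula;
`leviCivita I M Y x (X x)` is `∇_X Y` at `x`. -/
def leviCivita : CovariantDerivative I E (TangentSpace I : M → Type _) where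
  toFun := leviCivitaFun
  isCovariantDerivativeOnUniv := isCovariantDerivativeOn_leviCivitaFun

/-- The Levi-Civita connection is compatible with the metric. -/
theorem leviCivita_metric {X Y Z : Π x : M, TangentSpace I x} {x : M}
    (hX : MDiffAt (T% X) x) (hY : MDiffAt (T% Y) x) (hZ : MDiffAt (T% Z) x) :
    d% (fun y => inner ℝ (Y y) (Z y)) x (X x) =
      (inner ℝ (leviCivita I M Y x (X x)) (Z x) + inner ℝ (Y x) (leviCivita I M Z x (X x)) : ℝ) := by
  have h1 : (inner ℝ (leviCivita I M Y x (X x)) (Z x) : ℝ) = koszul Y X Z x :=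
    inner_leviCivitaFun_eq hY hX hZ
  have h2 : (inner ℝ (Y x) (leviCivita I M Z x (X x)) : ℝ) = koszul Z X Y x := by
    rw [real_inner_comm]; exact inner_leviCivitaFun_eq hZ hX hY
  have e1 : (fun y => inner ℝ (Z y) (Y y)) = fun y => inner ℝ (Y y) (Z y) := by
    ext y; exact real_inner_comm _ _
  simp only [h1, h2, koszul, e1, mlieBracket_swap_apply (V := Z) (W := Y), inner_neg_left]
  ring

/-- The Levi-Civita connection is torsion-free. -/
theorem leviCivita_torsion : (leviCivita I M).torsion = 0 := by
  rw [CovariantDerivative.torsion_eq_zero_iff]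
  intro X Y x hX hY
  refine ext_inner_right ℝ fun w => ?_
  obtain ⟨Z, hZ, rfl⟩ : ∃ Z : Π x : M, TangentSpace I x, MDiffAt (T% Z) x ∧ Z x = w :=
    ⟨FiberBundle.extend E w, FiberBundle.mdifferentiableAt_extend .., by simp⟩
  have h1 : (inner ℝ (leviCivita I M Y x (X x)) (Z x) : ℝ) = koszul Y X Z x :=
    inner_leviCivitaFun_eq hY hX hZ
  have h2 : (inner ℝ (leviCivita I M X x (Y x)) (Z x) : ℝ) = koszul X Y Z x :=
    inner_leviCivitaFun_eq hX hY hZ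
  have e1 : (fun y => inner ℝ (X y) (Y y)) = fun y => inner ℝ (Y y) (X y) := by
    ext y; exact real_inner_comm _ _
  rw [inner_sub_left, h1, h2]
  simp only [koszul, e1, mlieBracket_swap_apply (V := Y) (W := X), inner_neg_left]
  ring

end LeviCivita

section Algebra

/-- The quadratic form `-(x₁² + ⋯ + xₙ²)` on `ℝⁿ`. -/
def cliffordForm (n : ℕ) : QuadraticForm ℝ (Fin n → ℝ) :=
  QuadraticMap.weightedSumSquares ℝ (fun _ : Fin n => (-1 : ℝ))

/-- The real Clifford algebra of `ℝⁿ` with the relations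
`εᵢ εⱼ + εⱼ εᵢ = -2 δᵢⱼ`. -/
abbrev Cl (n : ℕ) : Type := CliffordAlgebra (cliffordForm n)

/-- The standard generators `εᵢ` of the Clifford algebra. -/
def gen {n : ℕ} (i : Fin n) : Cl n := CliffordAlgebra.ι (cliffordForm n) (Pi.single i 1)

end Algebra

section Geometry

variable {n : ℕ} {M : Type*} [TopologicalSpace M] [ChartedSpace (EuclideanSpace ℝ (Fin n)) M]
  [IsManifold (𝓡 n) ∞ M] [RiemannianBundle (fun x : M => TangentSpace (𝓡 n) x)]
  [IsContMDiffRiemannianBundle (𝓡 n) ∞ (EuclideanSpace ℝ (Fin n))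
    (fun x : M => TangentSpace (𝓡 n) x)]

variable (n M) in
/-- A spin structure (with the orientation it induces) on the Riemannian manifold `M`, described by
an atlas of the principal `Spin(n)`-bundle: an open cover `U α` with smooth orthonormal frames
`e^α`, together with smooth `Spin(n)`-valued functions `τ_αβ` on `U α ∩ U β` which satisfy the
cocycle condition and lift the transition functions of the frames, that is
`τ_αβ εⱼ τ_αβ⁻¹ = ∑ᵢ Λᵢⱼ εᵢ`, where `e^β_j = ∑ᵢ Λᵢⱼ e^α_i`, `Λᵢⱼ = g(e^α_i, e^β_j)`. As `Spin(n)`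
acts through `SO(n)`, the frames `e^α` are oriented consistently. -/
structure SpinStructure (ι : Type*) where
  U : ι → Set M
  isOpen_U : ∀ α, IsOpen (U α)
  exists_mem_U : ∀ x, ∃ α, x ∈ U α
  frame : ι → Fin n → Π x : M, TangentSpace (𝓡 n) x
  smooth_frame : ∀ α i, ContMDiffOn (𝓡 n) (𝓡 n).tangent ∞
    (fun x => (⟨x, frame α i x⟩ : TangentBundle (𝓡 n) M)) (U α)
  orthonormal_frame : ∀ α, ∀ x ∈ U α, Orthonormal ℝ (fun i => frame α i x)
  lift : ι → ι → M → Cl n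
  lift_mem_spin : ∀ α β, ∀ x ∈ U α ∩ U β, lift α β x ∈ spinGroup (cliffordForm n)
  smooth_lift : ∀ α β, ∀ l : Cl n →ₗ[ℝ] ℝ,
    ContMDiffOn (𝓡 n) 𝓘(ℝ, ℝ) ∞ (fun x => l (lift α β x)) (U α ∩ U β)
  lift_frame : ∀ α β, ∀ x ∈ U α ∩ U β, ∀ j,
    lift α β x * gen j =
      (∑ i, (inner ℝ (frame α i x) (frame β j x) : ℝ) • gen i) * lift α β x
  cocycle : ∀ α β γ, ∀ x ∈ U α ∩ U β ∩ U γ, lift α β x * lift β γ x = lift α γ x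

variable {ι : Type*} {Δ : Type*} [NormedAddCommGroup Δ] [NormedSpace ℂ Δ] [FiniteDimensional ℂ Δ]

/-- A smooth section of the bundle associated with the spin structure `S` and the complex Clifford
module `(Δ, ρ)` (the spinor bundle, when `ρ` is irreducible): its components `ψ_α : U α → Δ` in the
spin frames are smooth and satisfy `ψ_α = ρ(τ_αβ) ψ_β` on overlaps. -/
structure SpinorField (S : SpinStructure n M ι) (ρ : Cl n →ₐ[ℝ] Module.End ℂ Δ) where
  comp : ι → M → Δ
  smooth_comp : ∀ α, ContMDiffOn (𝓡 n) 𝓘(ℝ, Δ) ∞ (comp α) (S.U α)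
  transition : ∀ α β, ∀ x ∈ S.U α ∩ S.U β, comp α x = ρ (S.lift α β x) (comp β x)

/-- The curvature `R(X, Y)Z = ∇_X ∇_Y Z - ∇_Y ∇_X Z - ∇_[X,Y] Z` of the Levi-Civita connection. -/
def curvature (X Y Z : Π x : M, TangentSpace (𝓡 n) x) (x : M) : TangentSpace (𝓡 n) x :=
  leviCivita (𝓡 n) M (fun y => leviCivita (𝓡 n) M Z y (Y y)) x (X x)
    - leviCivita (𝓡 n) M (fun y => leviCivita (𝓡 n) M Z y (X y)) x (Y x)
    - leviCivita (𝓡 n) M Z x (mlieBracket (𝓡 n) X Y x)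

/-- The scalar curvature `s = ∑ᵢⱼ g(R(eᵢ, eⱼ)eⱼ, eᵢ)`, computed in a local orthonormal frame `e`. -/
def scalarCurvature (e : Fin n → Π x : M, TangentSpace (𝓡 n) x) (x : M) : ℝ :=
  ∑ i, ∑ j, inner ℝ (curvature (e i) (e j) (e j) x) (e i x)

/-- The pullback `(dφ)⁻¹ v` of a constant vector field `v` on `E` by a chart `φ` with values in `E`
(on the domain of `φ`). -/
def pullbackConst {E : Type*} [NormedAddCommGroup E] [NormedSpace ℝ E] {N : Type*}
    [TopologicalSpace N] [ChartedSpace E N] (φ : OpenPartialHomeomorph N E) (v : E) (x : N) :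
    TangentSpace 𝓘(ℝ, E) x :=
  mpullback 𝓘(ℝ, E) 𝓘(ℝ, E) φ (fun _ => v) x

/-- The coordinate vector fields `∂ⱼ` of a chart `φ` (on the domain of `φ`). -/
def coordField (φ : OpenPartialHomeomorph M (EuclideanSpace ℝ (Fin n))) (j : Fin n) (x : M) :
    TangentSpace (𝓡 n) x :=
  pullbackConst φ (EuclideanSpace.single j 1) x

/-- The inverse `(g^{ij})` of the Gram matrix `g_{ij} = g(bᵢ, bⱼ)` of a local frame `b`. -/
def inverseMetric (b : Fin n → Π x : M, TangentSpace (𝓡 n) x) (x : M) :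
    Matrix (Fin n) (Fin n) ℝ :=
  (Matrix.of fun i j => (inner ℝ (b i x) (b j x) : ℝ))⁻¹

/-- The operator `∑ g^{ij} (∇_{∂ᵢ} ∇_{∂ⱼ} - ∇_{∇^L_{∂ᵢ} ∂ⱼ})` in the coordinates `φ`, for a
connection `∇`, where `conn ψ x X` stands for `∇_X ψ` at `x`. -/
def connLaplacian (conn : (M → Δ) → Π x : M, TangentSpace (𝓡 n) x → Δ)
    (φ : OpenPartialHomeomorph M (EuclideanSpace ℝ (Fin n))) (ψ : M → Δ) (x : M) : Δ :=
  ∑ i, ∑ j, inverseMetric (coordField φ) x i j •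
    (conn (fun y => conn ψ y (coordField φ j y)) x (coordField φ i x)
      - conn ψ x (leviCivita (𝓡 n) M (coordField φ j) x (coordField φ i x)))

/-! In the following definitions `e` is a local orthonormal frame, and sections of the spinor bundle
and of its endomorphism bundle are given by their components in the spin frame over `e`. In this
spin frame `c(eᵢ)` is the constant endomorphism `ρ(εᵢ)`. -/

variable (ρ : Cl n →ₐ[ℝ] Module.End ℂ Δ) (e : Fin n → Π x : M, TangentSpace (𝓡 n) x)

/-- The Clifford action `c(X) = ∑ᵢ g(X, eᵢ) c(eᵢ)` of a tangent vector `X`. -/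
def cliff (x : M) (X : TangentSpace (𝓡 n) x) : Module.End ℂ Δ :=
  ∑ i, (inner ℝ X (e i x) : ℝ) • ρ (gen i)

/-- The connection matrix of the Levi-Civita connection, `∇^L eₜ = ∑ₛ ω_{s,t} eₛ`. -/
def connForm (s t : Fin n) (x : M) (X : TangentSpace (𝓡 n) x) : ℝ :=
  inner ℝ (leviCivita (𝓡 n) M (e t) x X) (e s x)

/-- `σ(X) = -¼ ∑ₛₜ ω_{s,t}(X) c(eₛ) c(eₜ)`. -/
def spinForm (x : M) (X : TangentSpace (𝓡 n) x) : Module.End ℂ Δ :=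
  (-(1 / 4) : ℝ) • ∑ s, ∑ t, connForm e s t x X • (ρ (gen s) * ρ (gen t))

/-- The spin connection `∇^S_X ψ = X ψ + σ(X) ψ`. -/
def spinConn (ψ : M → Δ) (x : M) (X : TangentSpace (𝓡 n) x) : Δ :=
  mvfderiv (𝓡 n) ψ x X + spinForm ρ e x X (ψ x)

/-- The covariant derivative of a section `A` of the endomorphism bundle in the direction `X` at
`x`: `(∇_X A) w = ∇^S_X (A w) - A ∇^S_X w`, for `w` extended constantly in the spin frame. -/
def endConn (A : M → Module.End ℂ Δ) (x : M) (X : TangentSpace (𝓡 n) x) (w : Δ) : Δ :=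
  spinConn ρ e (fun y => A y w) x X - A x (spinConn ρ e (fun _ => w) x X)

/-- The Dirac operator `D = ∑ᵢ c(eᵢ) (eᵢ - ¼ ∑ₛₜ ω_{s,t}(eᵢ) c(eₛ) c(eₜ))`. -/
def dirac (ψ : M → Δ) (x : M) : Δ :=
  ∑ i, ρ (gen i) (spinConn ρ e ψ x (e i x))

/-- `∑_{u<v} (p_{uv} - p_{vu}) c(e_u) c(e_v)`, where `p_{uv} = p(e_u, e_v)`. -/
def skewTerm (p : Π x : M, TangentSpace (𝓡 n) x →L[ℝ] TangentSpace (𝓡 n) x →L[ℝ] ℝ) (x : M) :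
    Module.End ℂ Δ :=
  ∑ u, ∑ v ∈ Finset.Ioi u,
    (p x (e u x) (e v x) - p x (e v x) (e u x)) • (ρ (gen u) * ρ (gen v))

/-- The operator `D̃ = D + f₁ ∑_{u<v} (p_{uv} - p_{vu}) c(e_u) c(e_v) + f₂`. -/
def diracWitten (p : Π x : M, TangentSpace (𝓡 n) x →L[ℝ] TangentSpace (𝓡 n) x →L[ℝ] ℝ)
    (f₁ f₂ : M → ℂ) (ψ : M → Δ) (x : M) : Δ :=
  dirac ρ e ψ x + f₁ x • skewTerm ρ e p x (ψ x) + f₂ x • ψ x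

/-- The operator `D̃* = D - conj f₁ ∑_{u<v} (p_{uv} - p_{vu}) c(e_u) c(e_v) + conj f₂`. -/
def diracWittenAdj (p : Π x : M, TangentSpace (𝓡 n) x →L[ℝ] TangentSpace (𝓡 n) x →L[ℝ] ℝ)
    (f₁ f₂ : M → ℂ) (ψ : M → Δ) (x : M) : Δ :=
  dirac ρ e ψ x - starRingEnd ℂ (f₁ x) • skewTerm ρ e p x (ψ x) + starRingEnd ℂ (f₂ x) • ψ x

/-- The connection `∇_X = ∇^S_X - ½ (c(X) A + B c(X))`. -/
def modConn (A B : M → Module.End ℂ Δ) (ψ : M → Δ) (x : M) (X : TangentSpace (𝓡 n) x) : Δ :=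
  spinConn ρ e ψ x X - (1 / 2 : ℝ) • (cliff ρ e x X * A x + B x * cliff ρ e x X) (ψ x)

end Geometry

end

end DiracWitten

open DiracWitten

namespace DiracWitten

/-! ### Vector fields and directional derivatives read in a chart; the bracket as a commutator. -/

section ChartPullback

variable {E : Type*} [NormedAddCommGroup E] [NormedSpace ℝ E] [CompleteSpace E]
  {F : Type*} [NormedAddCommGroup F] [NormedSpace ℝ F]
  {M : Type*} [TopologicalSpace M] [ChartedSpace E M] [IsManifold 𝓘(ℝ, E) ∞ M]

/-! Both identities are pointwise in one spin frame, and both are the case of a single Weitzenböck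
formula for `(D + B)(D + A)`, with `A`, `B` arbitrary smooth endomorphism fields
(`dirac_add_comp_dirac_add`). The special shape of `A` and `B` matters only at the very end, when
the zeroth order product `BA` (or `A²`) is multiplied out.

The formula comes from completing the square. Put `W_k = c(e_k) A + B c(e_k)`. Expanding the
product, `D²` is accompanied by the first order part `∑ W_k ∇^S_{e_k}` and the zeroth order part `∑
c(e_j)(∇^S_{e_j} A) + BA`. The connection `∇^S_{e_k} - ½ W_k` is chosen so that minus its Laplacian
has exactly this first order part. Its remaining zeroth order terms are `½ ∇^S W_k` and `-¼ W_k²`,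
and they account for the half difference and the sum of squares in the result.

For `D²` itself one needs the Lichnerowicz formula (`sum_gen_frameDeriv`). It rests on three facts:
Clifford multiplication is parallel (`endConn_gen`), the spin connection has as curvature the spin
image of the Riemann tensor (`frameDeriv_commutator`), and the contraction of that tensor with four
Clifford generators collapses to a scalar by the first Bianchi identity (`sum_curvature_clifford`).

The Laplacian is stated in arbitrary coordinates but computed in the orthonormal frame. Passing
between the two is the tensoriality of the second covariant derivative (`connLaplacian_matConn`). -/

theorem mdifferentiable_of_mem_maximalAtlas {φ : OpenPartialHomeomorph M E}
    (hφ : φ ∈ IsManifold.maximalAtlas 𝓘(ℝ, E) ∞ M) :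
    φ.MDifferentiable 𝓘(ℝ, E) 𝓘(ℝ, E) :=
  ⟨(contMDiffOn_of_mem_maximalAtlas hφ).mdifferentiableOn (by simp),
    (contMDiffOn_symm_of_mem_maximalAtlas hφ).mdifferentiableOn (by simp)⟩

theorem isInvertible_mfderiv_of_mem_maximalAtlas {φ : OpenPartialHomeomorph M E}
    (hφ : φ ∈ IsManifold.maximalAtlas 𝓘(ℝ, E) ∞ M) {x : M} (hx : x ∈ φ.source) :
    (mfderiv 𝓘(ℝ, E) 𝓘(ℝ, E) φ x).IsInvertible :=
  ⟨(mdifferentiable_of_mem_maximalAtlas hφ).mfderiv hx, rfl⟩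

/-- Near `x` one has `f = (f ∘ φ⁻¹) ∘ φ`, so the chain rule produces a factor `dφ`, which cancels
the inverse of `dφ` hidden in the pullback. -/
theorem mvfderiv_mpullback {φ : OpenPartialHomeomorph M E}
    (hφ : φ ∈ IsManifold.maximalAtlas 𝓘(ℝ, E) ∞ M) {x : M} (hx : x ∈ φ.source) {f : M → F}
    (hf : MDifferentiableAt 𝓘(ℝ, E) 𝓘(ℝ, F) f x) (V : E → E) :
    mvfderiv 𝓘(ℝ, E) f x (mpullback 𝓘(ℝ, E) 𝓘(ℝ, E) φ V x) =
      fderiv ℝ (f ∘ φ.symm) (φ x) (V (φ x)) := by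
  have hφ' := mdifferentiable_of_mem_maximalAtlas hφ
  have hinv := isInvertible_mfderiv_of_mem_maximalAtlas hφ hx
  have hs := hφ'.mdifferentiableAt_symm (φ.map_source hx)
  have hf' : MDifferentiableAt 𝓘(ℝ, E) 𝓘(ℝ, F) f (φ.symm (φ x)) := by rwa [φ.left_inv hx]
  have hg : MDifferentiableAt 𝓘(ℝ, E) 𝓘(ℝ, F) (f ∘ φ.symm) (φ x) := hf'.comp _ hs
  have hfe : f =ᶠ[𝓝 x] (f ∘ φ.symm) ∘ φ := by
    filter_upwards [φ.open_source.mem_nhds hx] with y hy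
    simp [φ.left_inv hy]
  have key : mfderiv 𝓘(ℝ, E) 𝓘(ℝ, F) f x = (mfderiv 𝓘(ℝ, E) 𝓘(ℝ, F) (f ∘ φ.symm) (φ x)).comp
      (mfderiv 𝓘(ℝ, E) 𝓘(ℝ, E) φ x) := by
    rw [hfe.mfderiv_eq]
    exact mfderiv_comp x hg (hφ'.mdifferentiableAt hx)
  change mfderiv 𝓘(ℝ, E) 𝓘(ℝ, F) f x
    ((mfderiv 𝓘(ℝ, E) 𝓘(ℝ, E) φ x).inverse (V (φ x))) = _
  rw [key, ← mfderiv_eq_fderiv]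
  change mfderiv 𝓘(ℝ, E) 𝓘(ℝ, F) (f ∘ φ.symm) (φ x)
    ((mfderiv 𝓘(ℝ, E) 𝓘(ℝ, E) φ x) ((mfderiv 𝓘(ℝ, E) 𝓘(ℝ, E) φ x).inverse (V (φ x)))) = _
  exact congrArg (mfderiv 𝓘(ℝ, E) 𝓘(ℝ, F) (f ∘ φ.symm) (φ x))
    (hinv.self_apply_inverse (V (φ x)))

theorem contMDiffAt_pullbackConst {φ : OpenPartialHomeomorph M E}
    (hφ : φ ∈ IsManifold.maximalAtlas 𝓘(ℝ, E) ∞ M) {x : M} (hx : x ∈ φ.source) (v : E) :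
    ContMDiffAt 𝓘(ℝ, E) 𝓘(ℝ, E).tangent ∞
      (fun y => (⟨y, pullbackConst φ v y⟩ : TangentBundle 𝓘(ℝ, E) M)) x := by
  refine ContMDiffAt.mpullback_vectorField_preimage (n := ∞) (V := fun _ : E => (v : E)) ?_
    (contMDiffAt_of_mem_maximalAtlas hφ hx) (isInvertible_mfderiv_of_mem_maximalAtlas hφ hx)
    (by simp)
  exact contMDiffAt_vectorSpace_iff_contDiffAt.2 contDiffAt_const

/-- A smooth vector field near `x`, read in the preferred chart at `x`. -/
theorem exists_contDiffAt_mpullback_chartAt {x : M} {V : Π y : M, TangentSpace 𝓘(ℝ, E) y}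
    (hV : ContMDiffAt 𝓘(ℝ, E) 𝓘(ℝ, E).tangent ∞
      (fun y => (⟨y, V y⟩ : TangentBundle 𝓘(ℝ, E) M)) x) :
    ContDiffAt ℝ ∞ (mpullbackWithin 𝓘(ℝ, E) 𝓘(ℝ, E) (chartAt E x).symm V Set.univ : E → E)
        (chartAt E x x) ∧
      V =ᶠ[𝓝 x] mpullback 𝓘(ℝ, E) 𝓘(ℝ, E) (chartAt E x)
        (mpullbackWithin 𝓘(ℝ, E) 𝓘(ℝ, E) (chartAt E x).symm V Set.univ) := by
  constructor
  · have h := contMDiffWithinAt_mpullbackWithin_extChartAt_symm (n := ∞) (m := ∞) (s := Set.univ)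
      (contMDiffWithinAt_univ.2 hV) uniqueMDiffOn_univ (Set.mem_univ x) (by simp)
    have h2 := contMDiffWithinAt_vectorSpace_iff_contDiffWithinAt.1 h
    have h3 := h2.contDiffAt (by
      simpa using (chartAt E x).open_target.mem_nhds (mem_chart_target E x))
    simpa using! h3
  · have h := eventuallyEq_mpullback_mpullbackWithin_extChartAt (I := 𝓘(ℝ, E)) (s := Set.univ)
      (x := x) V
    simpa using! h

theorem contDiffAt_comp_symm {x : M} {f : M → F} (hf : ContMDiffAt 𝓘(ℝ, E) 𝓘(ℝ, F) ∞ f x) :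
    ContDiffAt ℝ ∞ (f ∘ (chartAt E x).symm) (chartAt E x x) := by
  rw [← contMDiffAt_iff_contDiffAt]
  refine ContMDiffAt.comp (I' := 𝓘(ℝ, E)) _ ?_
    ((contMDiffOn_chart_symm (I := 𝓘(ℝ, E)) (n := ∞)).contMDiffAt
      ((chartAt E x).open_target.mem_nhds (mem_chart_target E x)))
  rwa [(chartAt E x).left_inv (mem_chart_source E x)]

/-- An equality of germs and not merely of values at `x`, because the function `V f` is going to be
differentiated again. -/
theorem mvfderiv_apply_eventuallyEq {x : M} {f : M → F}
    (hf : ContMDiffAt 𝓘(ℝ, E) 𝓘(ℝ, F) ∞ f x) {V : Π y : M, TangentSpace 𝓘(ℝ, E) y}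
    (hV : ContMDiffAt 𝓘(ℝ, E) 𝓘(ℝ, E).tangent ∞
      (fun y => (⟨y, V y⟩ : TangentBundle 𝓘(ℝ, E) M)) x) :
    (fun y => mvfderiv 𝓘(ℝ, E) f y (V y)) =ᶠ[𝓝 x] (fun u : E =>
      fderiv ℝ (f ∘ (chartAt E x).symm) u
        (mpullbackWithin 𝓘(ℝ, E) 𝓘(ℝ, E) (chartAt E x).symm V Set.univ u)) ∘ chartAt E x := by
  have hf1 : ∀ᶠ y in 𝓝 x, ContMDiffAt 𝓘(ℝ, E) 𝓘(ℝ, F) 1 f y :=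
    (contMDiffAt_iff_contMDiffAt_nhds (by simp)).1 (hf.of_le (by simp))
  filter_upwards [hf1, (exists_contDiffAt_mpullback_chartAt hV).2,
    (chartAt E x).open_source.mem_nhds (mem_chart_source E x)] with y h1 h2 h3
  have := mvfderiv_mpullback (F := F) (IsManifold.chart_mem_maximalAtlas x) h3
    (h1.mdifferentiableAt one_ne_zero)
    (mpullbackWithin 𝓘(ℝ, E) 𝓘(ℝ, E) (chartAt E x).symm V Set.univ : E → E)
  rw [h2]
  exact this

theorem contMDiffAt_mvfderiv_apply {x : M} {f : M → F}
    (hf : ContMDiffAt 𝓘(ℝ, E) 𝓘(ℝ, F) ∞ f x) {V : Π y : M, TangentSpace 𝓘(ℝ, E) y}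
    (hV : ContMDiffAt 𝓘(ℝ, E) 𝓘(ℝ, E).tangent ∞
      (fun y => (⟨y, V y⟩ : TangentBundle 𝓘(ℝ, E) M)) x) :
    ContMDiffAt 𝓘(ℝ, E) 𝓘(ℝ, F) ∞ (fun y => mvfderiv 𝓘(ℝ, E) f y (V y)) x := by
  refine ContMDiffAt.congr_of_eventuallyEq ?_ (mvfderiv_apply_eventuallyEq hf hV)
  refine ContMDiffAt.comp (I' := 𝓘(ℝ, E)) x ?_
    (contMDiffAt_of_mem_maximalAtlas (IsManifold.chart_mem_maximalAtlas x) (mem_chart_source E x))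
  rw [contMDiffAt_iff_contDiffAt]
  exact ((contDiffAt_comp_symm hf).fderiv_right (m := ∞) (by simp)).clm_apply
    (exists_contDiffAt_mpullback_chartAt hV).1

/-- The Lie bracket of vector fields is the commutator of the derivations they define. -/
theorem mvfderiv_mlieBracket {x : M} {f : M → F}
    (hf : ContMDiffAt 𝓘(ℝ, E) 𝓘(ℝ, F) ∞ f x) {V W : Π y : M, TangentSpace 𝓘(ℝ, E) y}
    (hV : ContMDiffAt 𝓘(ℝ, E) 𝓘(ℝ, E).tangent ∞
      (fun y => (⟨y, V y⟩ : TangentBundle 𝓘(ℝ, E) M)) x)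
    (hW : ContMDiffAt 𝓘(ℝ, E) 𝓘(ℝ, E).tangent ∞
      (fun y => (⟨y, W y⟩ : TangentBundle 𝓘(ℝ, E) M)) x) :
    mvfderiv 𝓘(ℝ, E) f x (mlieBracket 𝓘(ℝ, E) V W x) =
      mvfderiv 𝓘(ℝ, E) (fun y => mvfderiv 𝓘(ℝ, E) f y (W y)) x (V x)
        - mvfderiv 𝓘(ℝ, E) (fun y => mvfderiv 𝓘(ℝ, E) f y (V y)) x (W x) := by
  set φ := chartAt E x with hφdef
  have hφ : φ ∈ IsManifold.maximalAtlas 𝓘(ℝ, E) ∞ M := IsManifold.chart_mem_maximalAtlas x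
  have hx : x ∈ φ.source := mem_chart_source E x
  obtain ⟨hV', hVe⟩ := exists_contDiffAt_mpullback_chartAt hV
  obtain ⟨hW', hWe⟩ := exists_contDiffAt_mpullback_chartAt hW
  have eV := mvfderiv_apply_eventuallyEq hf hV
  have eW := mvfderiv_apply_eventuallyEq hf hW
  have hVx := hVe.self_of_nhds
  have hWx := hWe.self_of_nhds
  have hg := contDiffAt_comp_symm hf
  -- By definition the bracket on the manifold is the flat bracket in the preferred chart, pulled
  -- back.
  have hb : mlieBracket 𝓘(ℝ, E) V W x = mpullback 𝓘(ℝ, E) 𝓘(ℝ, E) φ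
      (lieBracket ℝ (mpullbackWithin 𝓘(ℝ, E) 𝓘(ℝ, E) (chartAt E x).symm V Set.univ : E → E)
        (mpullbackWithin 𝓘(ℝ, E) 𝓘(ℝ, E) (chartAt E x).symm W Set.univ : E → E)) x := by
    simp [mlieBracket, mlieBracketWithin, φ, mfld_simps]
    exact congrArg (fun L => mpullback 𝓘(ℝ, E) 𝓘(ℝ, E) (chartAt E x) L x)
      (lieBracketWithin_univ (𝕜 := ℝ)
        (V := (mpullback 𝓘(ℝ, E) 𝓘(ℝ, E) (chartAt E x).symm V : E → E))
        (W := (mpullback 𝓘(ℝ, E) 𝓘(ℝ, E) (chartAt E x).symm W : E → E)))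
  set V' : E → E := mpullbackWithin 𝓘(ℝ, E) 𝓘(ℝ, E) (chartAt E x).symm V Set.univ with hV'def
  set W' : E → E := mpullbackWithin 𝓘(ℝ, E) 𝓘(ℝ, E) (chartAt E x).symm W Set.univ with hW'def
  rw [← hφdef] at hV' hW' hVe hWe eV eW hVx hWx hg
  have hfx : MDifferentiableAt 𝓘(ℝ, E) 𝓘(ℝ, F) f x := hf.mdifferentiableAt (by simp)
  -- In the chart, `Y(Zf) = D²f(Y, Z) + Df(DZ · Y)`. Antisymmetrising kills the Hessian term, as the
  -- second derivative is symmetric, and leaves `Df` of the flat bracket.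
  have hdir : ∀ Z : E → E, ContDiffAt ℝ ∞ Z (φ x) → ∀ (k : M → F),
      k =ᶠ[𝓝 x] (fun u : E => fderiv ℝ (f ∘ φ.symm) u (Z u)) ∘ φ → ∀ Y : E → E,
      mvfderiv 𝓘(ℝ, E) k x (mpullback 𝓘(ℝ, E) 𝓘(ℝ, E) φ Y x) =
        fderiv ℝ (fderiv ℝ (f ∘ φ.symm)) (φ x) (Y (φ x)) (Z (φ x)) +
          fderiv ℝ (f ∘ φ.symm) (φ x) (fderiv ℝ Z (φ x) (Y (φ x))) := by
    intro Z hZ k hk Y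
    have hd1 : DifferentiableAt ℝ (fderiv ℝ (f ∘ φ.symm)) (φ x) :=
      (hg.fderiv_right (m := ∞) (by simp)).differentiableAt (by simp)
    have hd2 : DifferentiableAt ℝ Z (φ x) := hZ.differentiableAt (by simp)
    have hdd : DifferentiableAt ℝ (fun u : E => fderiv ℝ (f ∘ φ.symm) u (Z u)) (φ x) :=
      hd1.clm_apply hd2
    have hkx : MDifferentiableAt 𝓘(ℝ, E) 𝓘(ℝ, F) k x := by
      refine MDifferentiableAt.congr_of_eventuallyEq ?_ hk
      exact hdd.mdifferentiableAt.comp x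
        ((mdifferentiable_of_mem_maximalAtlas hφ).mdifferentiableAt hx)
    have hks : k ∘ φ.symm =ᶠ[𝓝 (φ x)] fun u : E => fderiv ℝ (f ∘ φ.symm) u (Z u) := by
      have ht : Filter.Tendsto φ.symm (𝓝 (φ x)) (𝓝 x) := φ.tendsto_symm hx
      filter_upwards [ht.eventually hk, φ.open_target.mem_nhds (φ.map_source hx)] with u hu hu'
      simp only [Function.comp_apply] at hu ⊢
      rw [hu, φ.right_inv hu']
    rw [mvfderiv_mpullback hφ hx hkx, hks.fderiv_eq, fderiv_clm_apply hd1 hd2]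
    simp [add_comm]
  have hsymm : IsSymmSndFDerivAt ℝ (f ∘ φ.symm) (φ x) :=
    hg.isSymmSndFDerivAt (by
    rw [minSmoothness_of_isRCLikeNormedField]; exact WithTop.coe_le_coe.2 le_top)
  rw [hb, mvfderiv_mpullback hφ hx hfx, hVx, hWx, hdir W' hW' _ eW, hdir V' hV' _ eV,
    hsymm.eq (V' (φ x))]
  simp only [lieBracket, map_sub]
  abel

end ChartPullback

end DiracWitten

namespace DiracWitten

/-! ### Contractions of curvature-type tensors with Clifford monomials. -/

section CliffordContraction

variable {ι : Type*} [Fintype ι]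

theorem sum_rotate {V : Type*} [AddCommMonoid V] (f : ι → ι → ι → V) :
    ∑ i, ∑ j, ∑ k, f j k i = ∑ i, ∑ j, ∑ k, f i j k := by
  rw [Finset.sum_comm]
  exact Finset.sum_congr rfl fun j _ => Finset.sum_comm

variable [DecidableEq ι] {A : Type*} [Ring A] [Algebra ℝ A] {c : ι → A}

/-- Contraction of a tensor which is skew in its first two arguments and satisfies the first
Bianchi identity with a Clifford monomial of degree three. -/
theorem sum_cubic_clifford
    (hc : ∀ i j, c i * c j + c j * c i = (if i = j then (-2 : ℝ) else 0) • (1 : A))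
    {r : ι → ι → ι → ℝ} (hr : ∀ i j k, r j i k = -r i j k)
    (hcyc : ∀ i j k, r i j k + r j k i + r k i j = 0) :
    ∑ i, ∑ j, ∑ k, r i j k • (c i * c j * c k) = (-2 : ℝ) • ∑ i, ∑ j, r i j j • c i := by
  have hc' : ∀ i j, c j * c i = (if i = j then (-2 : ℝ) else 0) • (1 : A) - c i * c j :=
    fun i j => eq_sub_of_add_eq' (hc i j)
  -- Each cyclic rotation of a cubic monomial costs only linear terms. After contraction with `r`
  -- the two rotations become `T + 2Q` and `T + 4Q`, while the cyclic identity makes the three sums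
  -- add up to zero. Hence `3T + 6Q = 0`.
  have h1 : ∀ i j k, c j * c k * c i = c i * c j * c k
      + (if i = k then (-2 : ℝ) else 0) • c j - (if i = j then (-2 : ℝ) else 0) • c k := by
    intro i j k
    rw [mul_assoc, hc' i k, mul_sub, mul_smul_comm, mul_one, ← mul_assoc, hc' i j, sub_mul,
      smul_mul_assoc, one_mul]
    abel
  have h2 : ∀ i j k, c k * c i * c j = c i * c j * c k
      + (if i = k then (-2 : ℝ) else 0) • c j - (if j = k then (-2 : ℝ) else 0) • c i := by
    intro i j k
    rw [hc' i k, sub_mul, smul_mul_assoc, one_mul, mul_assoc (c i) (c k), hc' j k, mul_sub,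
      mul_smul_comm, mul_one, ← mul_assoc]
    abel
  have hii : ∀ i k, r i i k = 0 := fun i k => by linarith [hr i i k]
  set T := ∑ i, ∑ j, ∑ k, r i j k • (c i * c j * c k) with hT
  set Q := ∑ i, ∑ j, r i j j • c i with hQ
  have hQ' : ∑ i, ∑ j, r i j i • c j = -Q := by
    rw [Finset.sum_comm, hQ, ← Finset.sum_neg_distrib]
    refine Finset.sum_congr rfl fun i _ => ?_
    rw [← Finset.sum_neg_distrib]
    exact Finset.sum_congr rfl fun j _ => by rw [hr, neg_smul]
  have s1 : ∑ i, ∑ j, ∑ k, r i j k • (c j * c k * c i) = T + (2 : ℝ) • Q := by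
    rw [Finset.sum_congr rfl fun i _ => Finset.sum_congr rfl fun j _ =>
      Finset.sum_congr rfl fun k _ => congrArg (r i j k • ·) (h1 i j k)]
    simp only [smul_add, smul_sub, Finset.sum_add_distrib, Finset.sum_sub_distrib]
    simp only [ite_smul, zero_smul, smul_ite, smul_zero, smul_smul, Finset.sum_ite_eq,
      Finset.mem_univ, if_true]
    have e1 : ∑ i, ∑ j, ∑ k, (if i = j then (r i j k * -2) • c k else 0) = 0 := by
      refine Finset.sum_eq_zero fun i _ => Finset.sum_eq_zero fun j _ =>
        Finset.sum_eq_zero fun k _ => ?_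
      split_ifs with h
      · subst h; simp [hii]
      · rfl
    have e2 : ∑ i, ∑ j, (r i j i * -2) • c j = (2 : ℝ) • Q := by
      simp only [mul_comm _ (-2 : ℝ), mul_smul, ← Finset.smul_sum, hQ']
      simp
    rw [e1, e2, ← hT, sub_zero]
  have s2 : ∑ i, ∑ j, ∑ k, r i j k • (c k * c i * c j) = T + (4 : ℝ) • Q := by
    rw [Finset.sum_congr rfl fun i _ => Finset.sum_congr rfl fun j _ =>
      Finset.sum_congr rfl fun k _ => congrArg (r i j k • ·) (h2 i j k)]
    simp only [smul_add, smul_sub, Finset.sum_add_distrib, Finset.sum_sub_distrib]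
    simp only [ite_smul, zero_smul, smul_ite, smul_zero, smul_smul, Finset.sum_ite_eq,
      Finset.mem_univ, if_true]
    have e2 : ∑ i, ∑ j, (r i j i * -2) • c j = (2 : ℝ) • Q := by
      simp only [mul_comm _ (-2 : ℝ), mul_smul, ← Finset.smul_sum, hQ']
      simp
    have e3 : ∑ i, ∑ j, (r i j j * -2) • c i = -(2 : ℝ) • Q := by
      simp only [mul_comm _ (-2 : ℝ), mul_smul, ← Finset.smul_sum, ← hQ]
    rw [e2, e3]
    module
  have s0 : T + ∑ i, ∑ j, ∑ k, r i j k • (c j * c k * c i)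
      + ∑ i, ∑ j, ∑ k, r i j k • (c k * c i * c j) = 0 := by
    have t1 : ∑ i, ∑ j, ∑ k, r i j k • (c j * c k * c i)
        = ∑ i, ∑ j, ∑ k, r k i j • (c i * c j * c k) :=
      sum_rotate fun i j k => r k i j • (c i * c j * c k)
    have t2 : ∑ i, ∑ j, ∑ k, r i j k • (c k * c i * c j)
        = ∑ i, ∑ j, ∑ k, r j k i • (c i * c j * c k) :=
      (sum_rotate fun i j k => r i j k • (c k * c i * c j)).symm
    rw [t1, t2, hT]
    simp only [← Finset.sum_add_distrib, ← add_smul]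
    refine Finset.sum_eq_zero fun i _ => Finset.sum_eq_zero fun j _ =>
      Finset.sum_eq_zero fun k _ => ?_
    rw [show r i j k + r k i j + r j k i = 0 by linarith [hcyc i j k], zero_smul]
  rw [s1, s2] at s0
  have : (3 : ℝ) • (T + (2 : ℝ) • Q) = 0 := by rw [← s0]; module
  rw [smul_eq_zero_iff_right (by norm_num)] at this
  rw [eq_neg_of_add_eq_zero_left this, neg_smul]

/-- Averaging the sum with its index swap replaces `c i * c j` by half the anticommutator, so only
the diagonal survives. -/
theorem sum_symm_clifford
    (hc : ∀ i j, c i * c j + c j * c i = (if i = j then (-2 : ℝ) else 0) • (1 : A))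
    {q : ι → ι → ℝ} (hq : ∀ i j, q i j = q j i) :
    ∑ i, ∑ j, q i j • (c i * c j) = -((∑ i, q i i) • (1 : A)) := by
  have h : (2 : ℝ) • ∑ i, ∑ j, q i j • (c i * c j) = (-2 : ℝ) • ((∑ i, q i i) • (1 : A)) := by
    rw [two_smul]
    nth_rw 2 [Finset.sum_comm]
    simp only [← Finset.sum_add_distrib]
    simp_rw [fun i j => hq j i, ← smul_add, hc, smul_smul, mul_ite, mul_zero, ite_smul, zero_smul,
      Finset.sum_ite_eq, Finset.mem_univ, if_true, mul_comm _ (-2 : ℝ), ← Finset.sum_smul,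
      Finset.mul_sum]
  have h2 : (2 : ℝ) • (∑ i, ∑ j, q i j • (c i * c j) + (∑ i, q i i) • (1 : A)) = 0 := by
    rw [smul_add, h]; module
  rw [smul_eq_zero_iff_right (by norm_num)] at h2
  exact eq_neg_of_add_eq_zero_left h2

/-- Contraction of an algebraic curvature tensor `R s t i j = g(R(eᵢ, eⱼ)eₜ, eₛ)` with a Clifford
monomial of degree four. -/
theorem sum_curvature_clifford
    (hc : ∀ i j, c i * c j + c j * c i = (if i = j then (-2 : ℝ) else 0) • (1 : A))
    {R : ι → ι → ι → ι → ℝ} (h₁ : ∀ s t i j, R t s i j = -R s t i j)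
    (h₂ : ∀ s t i j, R s t j i = -R s t i j)
    (h₃ : ∀ s t i j, R s t i j + R s i j t + R s j t i = 0) :
    ∑ i, ∑ j, ∑ s, ∑ t, R s t i j • (c i * c j * c s * c t)
      = (-2 : ℝ) • ((∑ i, ∑ j, R i j i j) • (1 : A)) := by
  -- Pair symmetry, by the classical octahedron argument: a combination of four Bianchi identities
  -- in which the skew symmetries cancel all other terms.
  have hpair : ∀ s t i j, R s t i j = R i j s t := by
    intro s t i j
    linarith [h₃ s t i j, h₃ t i j s, h₃ i j s t, h₃ j s t i, h₁ s t i j, h₁ s i j t, h₁ s j t i,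
      h₁ t i j s, h₁ t j s i, h₁ i j s t, h₂ s t i j, h₂ s i j t, h₂ s j t i,
      h₂ t i j s, h₂ t j s i, h₂ i j s t, h₂ t s i j, h₂ i s j t, h₂ j s t i, h₂ j t s i, h₂ i t j s]
  -- With `t` frozen, the cubic contraction applies to the first three factors and leaves `∑ j, R j
  -- t i j`, which is minus the Ricci tensor. Pair symmetry makes it symmetric in `i` and `t`, so
  -- the last product contracts to its trace.
  have e1 : ∑ i, ∑ j, ∑ s, ∑ t, R s t i j • (c i * c j * c s * c t)
      = ∑ t, (∑ i, ∑ j, ∑ s, R s t i j • (c i * c j * c s)) * c t := by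
    simp only [Finset.sum_mul, smul_mul_assoc]
    rw [sum_rotate (fun i j t => ∑ s, R s t i j • (c i * c j * c s * c t))]
    exact Finset.sum_congr rfl fun i _ => Finset.sum_congr rfl fun j _ => Finset.sum_comm
  have e2 : ∀ t, ∑ i, ∑ j, ∑ s, R s t i j • (c i * c j * c s)
      = (-2 : ℝ) • ∑ i, ∑ j, R j t i j • c i := fun t =>
    sum_cubic_clifford hc (r := fun i j s => R s t i j) (fun i j k => h₂ _ _ _ _)
      (fun i j s => by linarith [h₃ t s i j, h₁ s t i j, h₁ i t j s, h₁ j t s i])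
  have e3 := sum_symm_clifford hc (q := fun i t => ∑ j, R j t i j)
    (fun i t => Finset.sum_congr rfl fun j _ => by
      rw [hpair, h₁, h₂]; simp)
  rw [e1]
  simp only [e2, smul_mul_assoc, Finset.sum_mul, ← Finset.smul_sum]
  rw [Finset.sum_comm]
  simp only [Finset.sum_smul] at e3
  rw [e3, ← Finset.sum_neg_distrib, Finset.sum_comm, Finset.sum_smul]
  congr 1
  refine Finset.sum_congr rfl fun i _ => ?_
  rw [Finset.sum_smul, ← Finset.sum_neg_distrib]
  exact Finset.sum_congr rfl fun j _ => by rw [h₂ j i j i, neg_smul, neg_neg]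

end CliffordContraction

end DiracWitten

namespace DiracWitten

/-! ### Orthonormal frames: connection forms, structure equations and symmetries of the curvature.
-/

section FrameGeometry

variable {n : ℕ} {M : Type*} [TopologicalSpace M] [ChartedSpace (EuclideanSpace ℝ (Fin n)) M]
  [IsManifold (𝓡 n) ∞ M] [RiemannianBundle (fun x : M => TangentSpace (𝓡 n) x)]
  [IsContMDiffRiemannianBundle (𝓡 n) ∞ (EuclideanSpace ℝ (Fin n))
    (fun x : M => TangentSpace (𝓡 n) x)]

variable (M) in
theorem isManifold_minSmoothness (k : ℕ) : IsManifold (𝓡 n) (minSmoothness ℝ k) M := by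
  rw [minSmoothness_of_isRCLikeNormedField]
  exact IsManifold.of_le (n := ∞) (WithTop.coe_le_coe.2 le_top)

theorem minSmoothness_two_le : minSmoothness ℝ 2 ≤ ∞ := by
  rw [minSmoothness_of_isRCLikeNormedField]
  exact WithTop.coe_le_coe.2 le_top

/-- The vector field `X` is smooth at `x`. -/
abbrev SmoothFieldAt (X : Π x : M, TangentSpace (𝓡 n) x) (x : M) : Prop :=
  ContMDiffAt (𝓡 n) (𝓡 n).tangent ∞ (fun y => (⟨y, X y⟩ : TangentBundle (𝓡 n) M)) x

/-- `e` is a smooth orthonormal frame of the tangent bundle on the open set `U`. -/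
structure IsOrthonormalFrameOn (e : Fin n → Π x : M, TangentSpace (𝓡 n) x) (U : Set M) :
    Prop where
  isOpen : IsOpen U
  smooth : ∀ i, ∀ x ∈ U, SmoothFieldAt (e i) x
  orthonormal : ∀ x ∈ U, Orthonormal ℝ (fun i => e i x)

variable {X Y Z : Π x : M, TangentSpace (𝓡 n) x} {x : M}

theorem SmoothFieldAt.eventually (h : SmoothFieldAt X x) :
    ∀ᶠ y in 𝓝 x, MDifferentiableAt (𝓡 n) (𝓡 n).tangent
      (fun y => (⟨y, X y⟩ : TangentBundle (𝓡 n) M)) y := by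
  have h1 : ∀ᶠ y in 𝓝 x, ContMDiffAt (𝓡 n) (𝓡 n).tangent 1
      (fun y => (⟨y, X y⟩ : TangentBundle (𝓡 n) M)) y :=
    (contMDiffAt_iff_contMDiffAt_nhds (by simp)).1 (ContMDiffAt.of_le h (by simp))
  filter_upwards [h1] with y hy using hy.mdifferentiableAt one_ne_zero

theorem SmoothFieldAt.mdiffAt (h : SmoothFieldAt X x) :
    MDifferentiableAt (𝓡 n) (𝓡 n).tangent (fun y => (⟨y, X y⟩ : TangentBundle (𝓡 n) M)) x :=
  ContMDiffAt.mdifferentiableAt h (by simp)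

theorem SmoothFieldAt.inner (hX : SmoothFieldAt X x) (hY : SmoothFieldAt Y x) :
    ContMDiffAt (𝓡 n) 𝓘(ℝ, ℝ) ∞ (fun y => (inner ℝ (X y) (Y y) : ℝ)) x :=
  ContMDiffAt.inner_bundle (E := fun x : M => TangentSpace (𝓡 n) x)
    (F := EuclideanSpace ℝ (Fin n)) (b := fun y => y) hX hY

theorem SmoothFieldAt.mlieBracket (hX : SmoothFieldAt X x) (hY : SmoothFieldAt Y x) :
    SmoothFieldAt (mlieBracket (𝓡 n) X Y) x :=
  have := isManifold_minSmoothness (n := n) M 2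
  have : IsManifold (𝓡 n) (((⊤ : ℕ∞) : ℕ∞ω) + 1) M := by simpa
  ContMDiffAt.mlieBracket_vectorField (m := ⊤) (n := ⊤) hX hY (by simp)

theorem contMDiffAt_koszul (hX : SmoothFieldAt X x) (hY : SmoothFieldAt Y x)
    (hZ : SmoothFieldAt Z x) : ContMDiffAt (𝓡 n) 𝓘(ℝ, ℝ) ∞ (koszul Y X Z) x := by
  unfold koszul
  refine contMDiffAt_const.mul ?_
  refine ((((contMDiffAt_mvfderiv_apply (hY.inner hZ) hX).add
    (contMDiffAt_mvfderiv_apply (hX.inner hZ) hY)).sub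
    (contMDiffAt_mvfderiv_apply (hX.inner hY) hZ)).add
    ((hX.mlieBracket hY).inner hZ)).sub ((hX.mlieBracket hZ).inner hY) |>.sub
    ((hY.mlieBracket hZ).inner hX)

theorem contMDiffAt_inner_leviCivita (hX : SmoothFieldAt X x) (hY : SmoothFieldAt Y x)
    (hZ : SmoothFieldAt Z x) :
    ContMDiffAt (𝓡 n) 𝓘(ℝ, ℝ) ∞
      (fun y => (inner ℝ (leviCivita (𝓡 n) M Y y (X y)) (Z y) : ℝ)) x := by
  -- The Koszul expression computes the connection only at points where all three fields are
  -- differentiable, which holds on a neighbourhood.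
  refine (contMDiffAt_koszul hX hY hZ).congr_of_eventuallyEq ?_
  filter_upwards [hX.eventually, hY.eventually, hZ.eventually] with y h1 h2 h3
  exact inner_leviCivitaFun_eq h2 h1 h3

namespace IsOrthonormalFrameOn

variable {e : Fin n → Π x : M, TangentSpace (𝓡 n) x} {U : Set M}

/-- The orthonormal basis of the tangent space given by an orthonormal frame. -/
noncomputable def basis (h : IsOrthonormalFrameOn e U) (hx : x ∈ U) :
    OrthonormalBasis (Fin n) ℝ (TangentSpace (𝓡 n) x) :=
  OrthonormalBasis.mk (h.orthonormal x hx) (by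
    have hf : Module.finrank ℝ (TangentSpace (𝓡 n) x) = n := by
      change Module.finrank ℝ (EuclideanSpace ℝ (Fin n)) = n
      simp
    exact ((h.orthonormal x hx).linearIndependent.span_eq_top_of_card_eq_finrank'
      (by simp [hf])).ge)

theorem basis_apply (h : IsOrthonormalFrameOn e U) (hx : x ∈ U) (i : Fin n) :
    h.basis hx i = e i x := by
  simp [basis]

theorem sum_inner_smul (h : IsOrthonormalFrameOn e U) (hx : x ∈ U) (v : TangentSpace (𝓡 n) x) :
    ∑ i, (inner ℝ v (e i x) : ℝ) • e i x = v := by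
  have := (h.basis hx).sum_repr' v
  simp only [basis_apply] at this
  conv_rhs => rw [← this]
  exact Finset.sum_congr rfl fun i _ => by rw [real_inner_comm]

theorem inner_eq_ite (h : IsOrthonormalFrameOn e U) (hx : x ∈ U) (i j : Fin n) :
    (inner ℝ (e i x) (e j x) : ℝ) = if i = j then 1 else 0 :=
  orthonormal_iff_ite.1 (h.orthonormal x hx) i j

theorem inner_eq_sum (h : IsOrthonormalFrameOn e U) (hx : x ∈ U) (v w : TangentSpace (𝓡 n) x) :
    (inner ℝ v w : ℝ) = ∑ i, (inner ℝ v (e i x) : ℝ) * inner ℝ w (e i x) := by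
  conv_lhs => rw [← h.sum_inner_smul hx w]
  simp [inner_sum, inner_smul_right, mul_comm]

theorem ext_inner (h : IsOrthonormalFrameOn e U) (hx : x ∈ U) {v w : TangentSpace (𝓡 n) x}
    (hvw : ∀ i, (inner ℝ v (e i x) : ℝ) = inner ℝ w (e i x)) : v = w := by
  rw [← h.sum_inner_smul hx v, ← h.sum_inner_smul hx w]
  simp only [hvw]

theorem smoothFieldAt_of_inner (h : IsOrthonormalFrameOn e U) (hx : x ∈ U)
    (hX : ∀ i, ContMDiffAt (𝓡 n) 𝓘(ℝ, ℝ) ∞ (fun y => (inner ℝ (X y) (e i y) : ℝ)) x) :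
    SmoothFieldAt X x := by
  have h1 : SmoothFieldAt (fun y => ∑ i, (inner ℝ (X y) (e i y) : ℝ) • e i y) x :=
    ContMDiffAt.sum_section fun i _ => (hX i).smul_section (h.smooth i x hx)
  refine ContMDiffAt.congr_of_eventuallyEq h1 ?_
  filter_upwards [h.isOpen.mem_nhds hx] with y hy
  rw [h.sum_inner_smul hy]

theorem smoothFieldAt_leviCivita (h : IsOrthonormalFrameOn e U) (hx : x ∈ U)
    (hX : SmoothFieldAt X x) (hY : SmoothFieldAt Y x) :
    SmoothFieldAt (fun y => leviCivita (𝓡 n) M Y y (X y)) x :=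
  h.smoothFieldAt_of_inner hx fun i => contMDiffAt_inner_leviCivita hX hY (h.smooth i x hx)

theorem contMDiffAt_connForm (h : IsOrthonormalFrameOn e U) (hx : x ∈ U)
    (hX : SmoothFieldAt X x) (s t : Fin n) :
    ContMDiffAt (𝓡 n) 𝓘(ℝ, ℝ) ∞ (fun y => connForm e s t y (X y)) x :=
  contMDiffAt_inner_leviCivita hX (h.smooth t x hx) (h.smooth s x hx)

theorem leviCivita_frame (h : IsOrthonormalFrameOn e U) (hx : x ∈ U) (t : Fin n)
    (v : TangentSpace (𝓡 n) x) :
    leviCivita (𝓡 n) M (e t) x v = ∑ s, connForm e s t x v • e s x :=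
  (h.sum_inner_smul hx _).symm

/-- Metric compatibility is phrased for fields. This extends a single vector, with constant
components in the frame, so that it can be applied pointwise. -/
theorem exists_smoothFieldAt (h : IsOrthonormalFrameOn e U) (hx : x ∈ U)
    (v : TangentSpace (𝓡 n) x) : ∃ X, SmoothFieldAt X x ∧ X x = v :=
  ⟨fun y => ∑ i, (inner ℝ v (e i x) : ℝ) • e i y,
    ContMDiffAt.sum_section fun i _ => contMDiffAt_const.smul_section (h.smooth i x hx),
    h.sum_inner_smul hx v⟩

/-- Differentiate `g(e_t, e_s) = δ`, which is constant near `x`, using metric compatibility. -/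
theorem connForm_skew (h : IsOrthonormalFrameOn e U) (hx : x ∈ U) (s t : Fin n)
    (v : TangentSpace (𝓡 n) x) : connForm e s t x v = -connForm e t s x v := by
  obtain ⟨X, hX, rfl⟩ := h.exists_smoothFieldAt hx v
  have h1 := leviCivita_metric hX.mdiffAt (h.smooth t x hx).mdiffAt (h.smooth s x hx).mdiffAt
  have h2 : (fun y => (inner ℝ (e t y) (e s y) : ℝ)) =ᶠ[𝓝 x] fun _ => if t = s then 1 else 0 := by
    filter_upwards [h.isOpen.mem_nhds hx] with y hy using h.inner_eq_ite hy t s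
  have h3 : mvfderiv (𝓡 n) (fun y => (inner ℝ (e t y) (e s y) : ℝ)) x (X x) = 0 := by
    change mfderiv (𝓡 n) 𝓘(ℝ, ℝ) (fun y => (inner ℝ (e t y) (e s y) : ℝ)) x (X x) = 0
    rw [h2.mfderiv_eq, mfderiv_const]
    rfl
  rw [h3, real_inner_comm (leviCivita (𝓡 n) M (e s) x (X x))] at h1
  simp only [connForm]
  linarith

theorem mlieBracket_frame (h : IsOrthonormalFrameOn e U) (hx : x ∈ U) (i j : Fin n) :
    mlieBracket (𝓡 n) (e i) (e j) x =
      ∑ s, (connForm e s j x (e i x) - connForm e s i x (e j x)) • e s x := by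
  rw [← (CovariantDerivative.torsion_eq_zero_iff _).1 leviCivita_torsion
    (h.smooth i x hx).mdiffAt (h.smooth j x hx).mdiffAt, h.leviCivita_frame hx,
    h.leviCivita_frame hx]
  simp [sub_smul, Finset.sum_sub_distrib]

/-- The components of the curvature in an orthonormal frame, through the connection forms. -/
theorem inner_curvature_frame (h : IsOrthonormalFrameOn e U) (hx : x ∈ U) (i j s t : Fin n) :
    (inner ℝ (curvature (e i) (e j) (e t) x) (e s x) : ℝ) =
      mvfderiv (𝓡 n) (fun y => connForm e s t y (e j y)) x (e i x)
        - mvfderiv (𝓡 n) (fun y => connForm e s t y (e i y)) x (e j x)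
        - connForm e s t x (mlieBracket (𝓡 n) (e i) (e j) x)
        + ∑ r, (connForm e s r x (e i x) * connForm e r t x (e j x)
          - connForm e s r x (e j x) * connForm e r t x (e i x)) := by
  -- Metric compatibility moves the outer derivative off `∇_{e_l} e_t` at the price of pairing it
  -- with `∇_{e_k} e_s`. Skewness of `ω` turns that pairing into the matrix product `ω(e_k) ω(e_l)`.
  -- Antisymmetrising gives Cartan's second structure equation.
  have key : ∀ k l, (inner ℝ (leviCivita (𝓡 n) M (fun y => leviCivita (𝓡 n) M (e t) y (e l y)) x
      (e k x)) (e s x) : ℝ) = mvfderiv (𝓡 n) (fun y => connForm e s t y (e l y)) x (e k x)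
        + ∑ r, connForm e s r x (e k x) * connForm e r t x (e l x) := by
    intro k l
    have hY := h.smoothFieldAt_leviCivita hx (h.smooth l x hx) (h.smooth t x hx)
    have h1 := leviCivita_metric (h.smooth k x hx).mdiffAt hY.mdiffAt (h.smooth s x hx).mdiffAt
    rw [h.inner_eq_sum hx _ (leviCivita (𝓡 n) M (e s) x (e k x))] at h1
    have h2 : ∑ r, connForm e s r x (e k x) * connForm e r t x (e l x) =
        -∑ r, (inner ℝ (leviCivita (𝓡 n) M (e t) x (e l x)) (e r x) : ℝ) *
          inner ℝ (leviCivita (𝓡 n) M (e s) x (e k x)) (e r x) := by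
      rw [← Finset.sum_neg_distrib]
      refine Finset.sum_congr rfl fun r _ => ?_
      rw [h.connForm_skew hx s r]
      simp only [connForm]
      ring
    rw [h2]
    simp only [connForm]
    linarith
  simp only [curvature, inner_sub_left, key, Finset.sum_sub_distrib]
  simp only [connForm]
  ring

theorem inner_curvature_skew_left (e : Fin n → Π x : M, TangentSpace (𝓡 n) x) (x : M)
    (i j s t : Fin n) :
    (inner ℝ (curvature (e j) (e i) (e t) x) (e s x) : ℝ) =
      -inner ℝ (curvature (e i) (e j) (e t) x) (e s x) := by
  simp only [curvature, inner_sub_left, mlieBracket_swap_apply (V := e j) (W := e i), map_neg,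
    inner_neg_left]
  ring

/-- By the structure equation the curvature is `dω + ω ∧ ω`. As `ω` is skew, so are its derivatives
and the commutators of its values. -/
theorem inner_curvature_skew_right (h : IsOrthonormalFrameOn e U) (hx : x ∈ U)
    (i j s t : Fin n) :
    (inner ℝ (curvature (e i) (e j) (e s) x) (e t x) : ℝ) =
      -inner ℝ (curvature (e i) (e j) (e t) x) (e s x) := by
  have hd : ∀ k l, mvfderiv (𝓡 n) (fun y => connForm e t s y (e k y)) x (e l x) =
      -mvfderiv (𝓡 n) (fun y => connForm e s t y (e k y)) x (e l x) := by
    intro k l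
    have h1 : (fun y => connForm e t s y (e k y)) =ᶠ[𝓝 x] fun y => -connForm e s t y (e k y) := by
      filter_upwards [h.isOpen.mem_nhds hx] with y hy using h.connForm_skew hy t s _
    have h2 : mvfderiv (𝓡 n) (fun y => connForm e t s y (e k y)) x =
        mvfderiv (𝓡 n) (fun y => -connForm e s t y (e k y)) x := by
      simp only [mvfderiv, h1.mfderiv_eq]
      rfl
    rw [h2, mvfderiv_fun_neg]
    rfl
  rw [h.inner_curvature_frame hx, h.inner_curvature_frame hx, hd, hd, h.connForm_skew hx t s]
  have hq : ∑ r, (connForm e t r x (e i x) * connForm e r s x (e j x)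
          - connForm e t r x (e j x) * connForm e r s x (e i x)) =
      -∑ r, (connForm e s r x (e i x) * connForm e r t x (e j x)
          - connForm e s r x (e j x) * connForm e r t x (e i x)) := by
    rw [← Finset.sum_neg_distrib]
    refine Finset.sum_congr rfl fun r _ => ?_
    rw [h.connForm_skew hx t r, h.connForm_skew hx t r, h.connForm_skew hx r s,
      h.connForm_skew hx r s]
    ring
  rw [hq]
  ring

/-- Vanishing torsion as an equality of germs, so that a further covariant derivative can be applied
to both sides. -/
theorem leviCivita_sub_leviCivita (hX : SmoothFieldAt X x) (hY : SmoothFieldAt Y x) :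
    (fun y => leviCivita (𝓡 n) M Y y (X y) - leviCivita (𝓡 n) M X y (Y y)) =ᶠ[𝓝 x]
      mlieBracket (𝓡 n) X Y := by
  filter_upwards [hX.eventually, hY.eventually] with y h1 h2
  exact (CovariantDerivative.torsion_eq_zero_iff _).1 leviCivita_torsion h1 h2

/-- The first Bianchi identity. -/
theorem curvature_bianchi (h : IsOrthonormalFrameOn e U) (hx : x ∈ U) (hX : SmoothFieldAt X x)
    (hY : SmoothFieldAt Y x) (hZ : SmoothFieldAt Z x) :
    curvature X Y Z x + curvature Y Z X x + curvature Z X Y x = 0 := by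
  -- Torsion-freeness used twice: `∇_Y Z - ∇_Z Y = [Y, Z]`, and then `∇_X [Y, Z] - ∇_{[Y, Z]} X =
  -- [X, [Y, Z]]`. The cyclic sum of the left sides is the Bianchi sum, and that of the right sides
  -- vanishes by the Jacobi identity.
  have key : ∀ {X Y Z : Π x : M, TangentSpace (𝓡 n) x}, SmoothFieldAt X x → SmoothFieldAt Y x →
      SmoothFieldAt Z x →
      leviCivita (𝓡 n) M (fun y => leviCivita (𝓡 n) M Z y (Y y)) x (X x)
        - leviCivita (𝓡 n) M (fun y => leviCivita (𝓡 n) M Y y (Z y)) x (X x)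
        - leviCivita (𝓡 n) M X x (mlieBracket (𝓡 n) Y Z x)
      = mlieBracket (𝓡 n) X (mlieBracket (𝓡 n) Y Z) x := by
    intro X Y Z hX hY hZ
    have hYZ := h.smoothFieldAt_leviCivita hx hY hZ
    have hZY := h.smoothFieldAt_leviCivita hx hZ hY
    have hb := hY.mlieBracket hZ
    have e1 : leviCivita (𝓡 n) M (fun y => leviCivita (𝓡 n) M Z y (Y y)) x =
        leviCivita (𝓡 n) M (mlieBracket (𝓡 n) Y Z) x
          + leviCivita (𝓡 n) M (fun y => leviCivita (𝓡 n) M Y y (Z y)) x := by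
      rw [← (leviCivita (𝓡 n) M).isCovariantDerivativeOnUniv.add hb.mdiffAt hZY.mdiffAt]
      refine (leviCivita (𝓡 n) M).isCovariantDerivativeOnUniv.congr_of_eventuallyEq hYZ.mdiffAt
        (mdifferentiableAt_add_section hb.mdiffAt hZY.mdiffAt) Filter.univ_mem ?_
      filter_upwards [leviCivita_sub_leviCivita hY hZ] with y hy
      rw [Pi.add_apply, ← hy, sub_add_cancel]
    rw [← (CovariantDerivative.torsion_eq_zero_iff _).1 leviCivita_torsion hX.mdiffAt hb.mdiffAt,
      e1]
    simp
  have := isManifold_minSmoothness (n := n) M 3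
  have jac := leibniz_identity_mlieBracket_apply (I := 𝓡 n) (U := X) (V := Y) (W := Z) (x := x)
    (ContMDiffAt.of_le hX minSmoothness_two_le) (ContMDiffAt.of_le hY minSmoothness_two_le)
    (ContMDiffAt.of_le hZ minSmoothness_two_le)
  have k1 := key hX hY hZ
  have k2 := key hY hZ hX
  have k3 := key hZ hX hY
  have j1 : mlieBracket (𝓡 n) Y (mlieBracket (𝓡 n) Z X) x =
      -mlieBracket (𝓡 n) Y (mlieBracket (𝓡 n) X Z) x := by
    rw [mlieBracket_swap (V := Z) (W := X), mlieBracket_swap_apply (V := Y),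
      mlieBracket_swap_apply (V := Y) (W := mlieBracket (𝓡 n) X Z), neg_neg]
    have hb := hX.mlieBracket hZ
    have := mlieBracket_const_smul_left (I := 𝓡 n) (c := (-1 : ℝ)) (W := Y) hb.mdiffAt
    rw [neg_one_smul, neg_one_smul] at this
    rw [this, neg_neg]
  have j2 := mlieBracket_swap_apply (I := 𝓡 n) (V := Z) (W := mlieBracket (𝓡 n) X Y) (x := x)
  simp only [curvature]
  have : mlieBracket (𝓡 n) X (mlieBracket (𝓡 n) Y Z) x
      + mlieBracket (𝓡 n) Y (mlieBracket (𝓡 n) Z X) x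
      + mlieBracket (𝓡 n) Z (mlieBracket (𝓡 n) X Y) x = 0 := by
    rw [jac, j1, j2]; abel
  rw [← k1, ← k2, ← k3] at this
  rw [← this]
  abel

end IsOrthonormalFrameOn

end FrameGeometry

end DiracWitten

namespace DiracWitten

/-! ### The connection Laplacian: from coordinates to an orthonormal frame. -/

section FrameLaplacian

variable {n : ℕ} {M : Type*} [TopologicalSpace M] [ChartedSpace (EuclideanSpace ℝ (Fin n)) M]
  [IsManifold (𝓡 n) ∞ M]
  {F : Type*} [NormedAddCommGroup F] [NormedSpace ℝ F]

theorem sum_comm_pairs {ι κ V : Type*} [Fintype ι] [Fintype κ] [AddCommMonoid V]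
    (f : ι → ι → κ → κ → V) :
    ∑ k, ∑ l, ∑ i, ∑ j, f i j k l = ∑ i, ∑ j, ∑ k, ∑ l, f i j k l := by
  simpa only [Fintype.sum_prod_type] using
    Finset.sum_comm (s := (Finset.univ : Finset (κ × κ))) (t := (Finset.univ : Finset (ι × ι)))
      (f := fun q p => f p.1 p.2 q.1 q.2)

theorem mvfderiv_congr {f g : M → F} {x : M} (h : f =ᶠ[𝓝 x] g) :
    mvfderiv (𝓡 n) f x = mvfderiv (𝓡 n) g x := by
  simp only [mvfderiv, h.mfderiv_eq]
  rfl

theorem mvfderiv_fun_sum {κ : Type*} (s : Finset κ) {f : κ → M → F} {x : M}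
    (hf : ∀ k ∈ s, MDifferentiableAt (𝓡 n) 𝓘(ℝ, F) (f k) x) :
    mvfderiv (𝓡 n) (fun y => ∑ k ∈ s, f k y) x = ∑ k ∈ s, mvfderiv (𝓡 n) (f k) x ∧
      MDifferentiableAt (𝓡 n) 𝓘(ℝ, F) (fun y => ∑ k ∈ s, f k y) x := by
  classical
  induction s using Finset.induction_on with
  | empty => simpa using ⟨mvfderiv_const 0, mdifferentiableAt_const⟩
  | insert k s hk ih =>
    obtain ⟨h1, h2⟩ := ih fun j hj => hf j (Finset.mem_insert_of_mem hj)
    have h3 := hf k (Finset.mem_insert_self k s)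
    simp only [Finset.sum_insert hk]
    exact ⟨by rw [mvfderiv_fun_add h3 h2, h1], h3.add h2⟩

theorem contMDiffAt_fun_sum {κ : Type*} (s : Finset κ) {f : κ → M → F} {x : M}
    (hf : ∀ k ∈ s, ContMDiffAt (𝓡 n) 𝓘(ℝ, F) ∞ (f k) x) :
    ContMDiffAt (𝓡 n) 𝓘(ℝ, F) ∞ (fun y => ∑ k ∈ s, f k y) x := by
  classical
  induction s using Finset.induction_on with
  | empty => simpa using contMDiffAt_const
  | insert k s hk ih =>
    simp only [Finset.sum_insert hk]
    exact (hf k (Finset.mem_insert_self k s)).add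
      (ih fun j hj => hf j (Finset.mem_insert_of_mem hj))

variable {Δ : Type*} [NormedAddCommGroup Δ] [NormedSpace ℂ Δ]

/-- The connection `X + L(X)` on `Δ`-valued functions, for an endomorphism-valued one-form `L`. -/
noncomputable def matConn (L : Π x : M, TangentSpace (𝓡 n) x →ₗ[ℝ] Module.End ℂ Δ) (ψ : M → Δ)
    (x : M) (X : TangentSpace (𝓡 n) x) : Δ :=
  mvfderiv (𝓡 n) ψ x X + L x X (ψ x)

section MatConn

variable (L : Π x : M, TangentSpace (𝓡 n) x →ₗ[ℝ] Module.End ℂ Δ) {ψ χ : M → Δ} {x : M}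

theorem matConn_congr (h : ψ =ᶠ[𝓝 x] χ) : matConn L ψ x = matConn L χ x := by
  ext v
  rw [matConn, matConn, mvfderiv_congr h, h.self_of_nhds]

theorem matConn_sum (ψ : M → Δ) (x : M) {κ : Type*} (s : Finset κ) (a : κ → ℝ)
    (v : κ → TangentSpace (𝓡 n) x) :
    matConn L ψ x (∑ k ∈ s, a k • v k) = ∑ k ∈ s, a k • matConn L ψ x (v k) := by
  simp [matConn, map_sum, Finset.sum_add_distrib, smul_add, LinearMap.sum_apply]

theorem matConn_add_smul (ψ : M → Δ) (x : M) (a : ℝ) (v w : TangentSpace (𝓡 n) x) :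
    matConn L ψ x (v + a • w) = matConn L ψ x v + a • matConn L ψ x w := by
  simp [matConn]
  abel

theorem matConn_sum_smul {κ : Type*} (s : Finset κ) {a : κ → M → ℝ} {f : κ → M → Δ}
    (ha : ∀ k, MDifferentiableAt (𝓡 n) 𝓘(ℝ, ℝ) (a k) x)
    (hf : ∀ k, MDifferentiableAt (𝓡 n) 𝓘(ℝ, Δ) (f k) x) (v : TangentSpace (𝓡 n) x) :
    matConn L (fun y => ∑ k ∈ s, a k y • f k y) x v =
      ∑ k ∈ s, (mvfderiv (𝓡 n) (a k) x v • f k x + a k x • matConn L (f k) x v) := by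
  have h := (mvfderiv_fun_sum (n := n) s (f := fun k y => a k y • f k y) (x := x)
    fun k _ => (ha k).smul (hf k)).1
  simp only [matConn, h, smul_add, Finset.sum_add_distrib, map_sum]
  simp only [mvfderiv_fun_smul (ha _) (hf _), sum_apply, add_apply,
    ContinuousLinearMap.smulRight_apply, Finset.sum_add_distrib]
  simp
  abel

end MatConn

variable [RiemannianBundle (fun x : M => TangentSpace (𝓡 n) x)]
  [IsContMDiffRiemannianBundle (𝓡 n) ∞ (EuclideanSpace ℝ (Fin n))
    (fun x : M => TangentSpace (𝓡 n) x)]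
  {e : Fin n → Π x : M, TangentSpace (𝓡 n) x} {U : Set M} {x : M}

/-- The coefficients are the entries of `dφ(v)`; applying the inverse of `dφ` to their standard
expansion returns `v`. -/
theorem sum_smul_coordField {φ : OpenPartialHomeomorph M (EuclideanSpace ℝ (Fin n))}
    (hφ : φ ∈ IsManifold.maximalAtlas (𝓡 n) ∞ M) (hx : x ∈ φ.source)
    (v : TangentSpace (𝓡 n) x) :
    ∃ a : Fin n → ℝ, ∑ j, a j • coordField φ j x = v := by
  have hinv := isInvertible_mfderiv_of_mem_maximalAtlas hφ hx
  let w : EuclideanSpace ℝ (Fin n) := mfderiv (𝓡 n) (𝓡 n) φ x v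
  refine ⟨fun j => w j, ?_⟩
  have h1 : ∑ j, w j • EuclideanSpace.single j (1 : ℝ) = w := by
    simpa using (EuclideanSpace.basisFun (Fin n) ℝ).sum_repr w
  have h2 := congrArg (mfderiv (𝓡 n) (𝓡 n) φ x).inverse h1
  refine Eq.trans ?_ (h2.trans (hinv.inverse_apply_self v))
  exact (map_sum ((mfderiv (𝓡 n) (𝓡 n) φ x).inverse) _ _ |>.trans
    (Finset.sum_congr rfl fun j _ => map_smul _ _ _)).symm

namespace IsOrthonormalFrameOn

/-- The components of `∇_v Y` in an orthonormal frame. -/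
theorem leviCivita_eq_sum (h : IsOrthonormalFrameOn e U) (hx : x ∈ U)
    {Y : Π x : M, TangentSpace (𝓡 n) x} (hY : SmoothFieldAt Y x) (v : TangentSpace (𝓡 n) x) :
    leviCivita (𝓡 n) M Y x v = ∑ k, (mvfderiv (𝓡 n) (fun y => (inner ℝ (Y y) (e k y) : ℝ)) x v • e k x
      + (inner ℝ (Y x) (e k x) : ℝ) • leviCivita (𝓡 n) M (e k) x v) := by
  obtain ⟨X, hX, rfl⟩ := h.exists_smoothFieldAt hx v
  refine h.ext_inner hx fun s => ?_
  have h1 := leviCivita_metric hX.mdiffAt hY.mdiffAt (h.smooth s x hx).mdiffAt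
  rw [h.inner_eq_sum hx (Y x)] at h1
  rw [eq_sub_of_add_eq h1.symm]
  simp only [sum_inner, inner_add_left, inner_smul_left, Finset.sum_add_distrib,
    h.inner_eq_ite hx]
  simp only [mul_ite, mul_one, mul_zero, Finset.sum_ite_eq', Finset.mem_univ, if_true]
  have h2 : ∀ k, (inner ℝ (leviCivita (𝓡 n) M (e s) x (X x)) (e k x) : ℝ) =
      -inner ℝ (leviCivita (𝓡 n) M (e k) x (X x)) (e s x) :=
    fun k => h.connForm_skew hx k s (X x)
  simp [h2]

/-- The Gram matrix of the coordinate fields in terms of their components in an orthonormal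
frame. -/
theorem sum_inverseMetric (h : IsOrthonormalFrameOn e U) (hx : x ∈ U)
    {φ : OpenPartialHomeomorph M (EuclideanSpace ℝ (Fin n))}
    (hφ : φ ∈ IsManifold.maximalAtlas (𝓡 n) ∞ M) (hxφ : x ∈ φ.source) (l k : Fin n) :
    ∑ i, ∑ j, inverseMetric (coordField φ) x i j *
      ((inner ℝ (coordField φ i x) (e l x) : ℝ) * inner ℝ (coordField φ j x) (e k x)) =
      if l = k then 1 else 0 := by
  choose c hc using fun k => sum_smul_coordField hφ hxφ (e k x)
  set a : Matrix (Fin n) (Fin n) ℝ := Matrix.of fun j k => (inner ℝ (coordField φ j x) (e k x) : ℝ)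
    with ha
  -- The coordinate fields span, so expanding each `e_k` in them gives a left inverse of the
  -- component matrix `a`. Since the Gram matrix is `a aᵀ`, invertibility of `a` yields `aᵀ G⁻¹ a =
  -- 1`.
  have hca : Matrix.of c * a = 1 := by
    ext k l
    have := congrArg (fun w => (inner ℝ w (e l x) : ℝ)) (hc k)
    simp only [sum_inner, inner_smul_left, h.inner_eq_ite hx] at this
    simpa [Matrix.mul_apply, Matrix.one_apply, ha] using this
  have hu : IsUnit a.det := Matrix.isUnit_det_of_left_inverse hca
  have hG : (Matrix.of fun i j => (inner ℝ (coordField φ i x) (coordField φ j x) : ℝ))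
      = a * a.transpose := by
    ext i j
    rw [Matrix.mul_apply]
    exact h.inner_eq_sum hx _ _
  have key : a.transpose * inverseMetric (coordField φ) x * a = 1 := by
    rw [inverseMetric, hG, Matrix.mul_inv_rev, ← mul_assoc,
      Matrix.mul_nonsing_inv _ (by rwa [Matrix.det_transpose]), one_mul, Matrix.nonsing_inv_mul _ hu]
  have := congrFun (congrFun key l) k
  rw [Matrix.one_apply, Matrix.mul_apply] at this
  rw [← this, Finset.sum_comm]
  simp only [Matrix.mul_apply, Finset.sum_mul]
  refine Finset.sum_congr rfl fun j _ => Finset.sum_congr rfl fun i _ => ?_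
  simp [ha]
  ring

/-- The connection Laplacian in coordinates equals the one in an orthonormal frame. -/
theorem connLaplacian_matConn (h : IsOrthonormalFrameOn e U) (hx : x ∈ U)
    {φ : OpenPartialHomeomorph M (EuclideanSpace ℝ (Fin n))}
    (hφ : φ ∈ IsManifold.maximalAtlas (𝓡 n) ∞ M) (hxφ : x ∈ φ.source)
    (L : Π x : M, TangentSpace (𝓡 n) x →ₗ[ℝ] Module.End ℂ Δ) {ψ : M → Δ}
    (hψ : ∀ k, MDifferentiableAt (𝓡 n) 𝓘(ℝ, Δ) (fun y => matConn L ψ y (e k y)) x) :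
    connLaplacian (matConn L) φ ψ x =
      ∑ k, (matConn L (fun y => matConn L ψ y (e k y)) x (e k x)
        - matConn L ψ x (leviCivita (𝓡 n) M (e k) x (e k x))) := by
  have hb : ∀ j, SmoothFieldAt (coordField φ j) x := fun j => contMDiffAt_pullbackConst hφ hxφ _
  have ha : ∀ j k, MDifferentiableAt (𝓡 n) 𝓘(ℝ, ℝ)
      (fun y => (inner ℝ (coordField φ j y) (e k y) : ℝ)) x := fun j k =>
    ((hb j).inner (h.smooth k x hx)).mdifferentiableAt (by simp)
  -- The second covariant derivative `∇²_{v, e_k} ψ`. It is tensorial in both slots: derivatives of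
  -- the coefficients of `∂_j` in the frame appear in both of its terms and cancel (`e1`), and
  -- linearity in `v` is clear (`e2`). What remains is the contraction of `g^{ij}` with frame
  -- components, a Kronecker delta.
  set H : Fin n → TangentSpace (𝓡 n) x → Δ := fun k v =>
    matConn L (fun y => matConn L ψ y (e k y)) x v
      - matConn L ψ x (leviCivita (𝓡 n) M (e k) x v) with hH
  have e1 : ∀ j v, matConn L (fun y => matConn L ψ y (coordField φ j y)) x v
      - matConn L ψ x (leviCivita (𝓡 n) M (coordField φ j) x v)
      = ∑ k, (inner ℝ (coordField φ j x) (e k x) : ℝ) • H k v := by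
    intro j v
    have hev : (fun y => matConn L ψ y (coordField φ j y)) =ᶠ[𝓝 x] fun y =>
        ∑ k, (inner ℝ (coordField φ j y) (e k y) : ℝ) • matConn L ψ y (e k y) := by
      filter_upwards [h.isOpen.mem_nhds hx] with y hy
      rw [← matConn_sum, h.sum_inner_smul hy]
    rw [matConn_congr L hev, matConn_sum_smul L _ (ha j) hψ, h.leviCivita_eq_sum hx (hb j),
      Finset.sum_add_distrib]
    have h2 := matConn_add_smul L ψ x 1
      (∑ k, mvfderiv (𝓡 n) (fun y => (inner ℝ (coordField φ j y) (e k y) : ℝ)) x v • e k x)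
      (∑ k, (inner ℝ (coordField φ j x) (e k x) : ℝ) • leviCivita (𝓡 n) M (e k) x v)
    rw [one_smul, one_smul] at h2
    rw [Finset.sum_add_distrib, h2, matConn_sum, matConn_sum]
    simp only [hH, smul_sub, Finset.sum_sub_distrib]
    abel
  have e2 : ∀ i k, H k (coordField φ i x) =
      ∑ l, (inner ℝ (coordField φ i x) (e l x) : ℝ) • H k (e l x) := by
    intro i k
    conv_lhs => rw [← h.sum_inner_smul hx (coordField φ i x)]
    simp only [hH, matConn_sum, map_sum, map_smul, smul_sub, Finset.sum_sub_distrib]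
  simp only [connLaplacian, e1, e2, Finset.smul_sum, smul_smul]
  have e3 : ∀ k l, ∑ i, ∑ j, (inverseMetric (coordField φ) x i j *
      ((inner ℝ (coordField φ j x) (e k x) : ℝ) * inner ℝ (coordField φ i x) (e l x))) • H k (e l x)
      = (if l = k then (1 : ℝ) else 0) • H k (e l x) := by
    intro k l
    rw [← h.sum_inverseMetric hx hφ hxφ l k]
    simp only [Finset.sum_smul]
    exact Finset.sum_congr rfl fun i _ => Finset.sum_congr rfl fun j _ => by
      rw [mul_comm (inner ℝ (coordField φ j x) (e k x) : ℝ)]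
  calc _ = ∑ k, ∑ l, ∑ i, ∑ j, (inverseMetric (coordField φ) x i j *
      ((inner ℝ (coordField φ j x) (e k x) : ℝ) * inner ℝ (coordField φ i x) (e l x)))
        • H k (e l x) := by
        rw [sum_comm_pairs]
    _ = ∑ k, H k (e k x) := by
        refine Finset.sum_congr rfl fun k _ => ?_
        simp only [e3]
        simp

end IsOrthonormalFrameOn

end FrameLaplacian

end DiracWitten

namespace DiracWitten

/-! ### The infinitesimal spin representation. -/

section SpinMatrix

variable {ι : Type*} [Fintype ι] [DecidableEq ι] {A : Type*} [Ring A] [Algebra ℝ A]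

/-- The image `-¼ ∑ wₛₜ cₛ cₜ` of a matrix under the spin representation. -/
noncomputable def spinMatrix (c : ι → A) (w : ι → ι → ℝ) : A :=
  (-(1 / 4) : ℝ) • ∑ s, ∑ t, w s t • (c s * c t)

variable {c : ι → A}

/-- The infinitesimal form of the covering `Spin(n) → SO(n)`. Moving `c k` through `c s * c t`
leaves two contraction terms, equal by skewness of `w`, with total coefficient `-4`; the
normalisation `-¼` turns this into `1`. -/
theorem spinMatrix_commutator
    (hc : ∀ i j, c i * c j + c j * c i = (if i = j then (-2 : ℝ) else 0) • (1 : A))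
    {w : ι → ι → ℝ} (hw : ∀ s t, w s t = -w t s) (k : ι) :
    spinMatrix c w * c k = c k * spinMatrix c w + ∑ s, w s k • c s := by
  have h1 : ∀ s t, c s * c t * c k = c k * (c s * c t) + (if t = k then (-2 : ℝ) else 0) • c s
      - (if s = k then (-2 : ℝ) else 0) • c t := by
    intro s t
    rw [mul_assoc, eq_sub_of_add_eq (hc t k), mul_sub, ← mul_assoc (c s), eq_sub_of_add_eq (hc s k)]
    simp only [mul_smul_comm, mul_one, sub_mul, smul_mul_assoc, one_mul, mul_assoc]
    abel
  have h2 : ∑ s, ∑ t, w s t • (c s * c t * c k) =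
      ∑ s, ∑ t, w s t • (c k * (c s * c t)) + (-4 : ℝ) • ∑ s, w s k • c s := by
    rw [Finset.sum_congr rfl fun s _ => Finset.sum_congr rfl fun t _ =>
      congrArg (w s t • ·) (h1 s t)]
    simp only [smul_add, smul_sub, Finset.sum_add_distrib, Finset.sum_sub_distrib]
    have e1 : ∑ s, ∑ t, w s t • ((if t = k then (-2 : ℝ) else 0) • c s) =
        (-2 : ℝ) • ∑ s, w s k • c s := by
      simp only [ite_smul, zero_smul, smul_ite, smul_zero, Finset.sum_ite_eq', Finset.mem_univ,
        if_true, Finset.smul_sum]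
      exact Finset.sum_congr rfl fun s _ => smul_comm _ _ _
    have e2 : ∑ s, ∑ t, w s t • ((if s = k then (-2 : ℝ) else 0) • c t) =
        (2 : ℝ) • ∑ s, w s k • c s := by
      rw [Finset.sum_comm]
      simp only [ite_smul, zero_smul, smul_ite, smul_zero, Finset.sum_ite_eq', Finset.mem_univ,
        if_true, Finset.smul_sum]
      refine Finset.sum_congr rfl fun s _ => ?_
      rw [hw k s]
      module
    rw [e1, e2]
    module
  rw [spinMatrix, smul_mul_assoc, mul_smul_comm]
  simp only [Finset.sum_mul, Finset.mul_sum, smul_mul_assoc, mul_smul_comm]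
  rw [h2]
  module

/-- The spin representation respects brackets: the commutator with `spinMatrix c w` is a derivation,
so it acts on each factor of `c p * c q` through `w`, and skewness of `w` reassembles the result
into the matrix commutator. -/
theorem spinMatrix_mul_sub_mul
    (hc : ∀ i j, c i * c j + c j * c i = (if i = j then (-2 : ℝ) else 0) • (1 : A))
    {w v : ι → ι → ℝ} (hw : ∀ s t, w s t = -w t s) :
    spinMatrix c w * spinMatrix c v - spinMatrix c v * spinMatrix c w =
      spinMatrix c fun s t => ∑ r, (w s r * v r t - v s r * w r t) := by
  have h1 : ∀ p q, spinMatrix c w * (c p * c q) = c p * c q * spinMatrix c w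
      + ∑ s, w s p • (c s * c q) + ∑ s, w s q • (c p * c s) := by
    intro p q
    rw [← mul_assoc, spinMatrix_commutator hc hw, add_mul, mul_assoc (c p),
      spinMatrix_commutator hc hw, mul_add, Finset.sum_mul, Finset.mul_sum]
    simp only [smul_mul_assoc, mul_smul_comm, mul_assoc]
    abel
  have h2 : spinMatrix c w * spinMatrix c v - spinMatrix c v * spinMatrix c w =
      (-(1 / 4) : ℝ) • (∑ p, ∑ q, v p q • ∑ s, w s p • (c s * c q)
        + ∑ p, ∑ q, v p q • ∑ s, w s q • (c p * c s)) := by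
    conv_lhs => rw [spinMatrix.eq_def c v]
    rw [smul_mul_assoc, mul_smul_comm, ← smul_sub]
    congr 1
    simp only [Finset.sum_mul, Finset.mul_sum, smul_mul_assoc, mul_smul_comm]
    rw [Finset.sum_congr rfl fun s _ => Finset.sum_congr rfl fun t _ =>
      congrArg (v s t • ·) (h1 s t)]
    simp only [smul_add, Finset.sum_add_distrib]
    abel
  rw [h2, spinMatrix]
  congr 1
  have e1 : ∑ p, ∑ q, v p q • ∑ s, w s p • (c s * c q) =
      ∑ s, ∑ t, (∑ r, w s r * v r t) • (c s * c t) := by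
    simp only [Finset.smul_sum, Finset.sum_smul, smul_smul]
    rw [← sum_rotate]
    refine Finset.sum_congr rfl fun s _ => ?_
    rw [Finset.sum_comm]
    exact Finset.sum_congr rfl fun t _ => Finset.sum_congr rfl fun r _ => by rw [mul_comm]
  have e2 : ∑ p, ∑ q, v p q • ∑ s, w s q • (c p * c s) =
      -∑ s, ∑ t, (∑ r, v s r * w r t) • (c s * c t) := by
    rw [← Finset.sum_neg_distrib]
    refine Finset.sum_congr rfl fun s _ => ?_
    simp only [Finset.smul_sum, Finset.sum_smul, smul_smul]
    rw [Finset.sum_comm, ← Finset.sum_neg_distrib]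
    refine Finset.sum_congr rfl fun t _ => ?_
    rw [← Finset.sum_neg_distrib]
    exact Finset.sum_congr rfl fun r _ => by rw [hw t r, mul_neg, neg_smul]
  rw [e1, e2]
  simp only [Finset.sum_sub_distrib, sub_smul]
  abel

end SpinMatrix

theorem gen_mul_gen_add {n : ℕ} (i j : Fin n) :
    gen i * gen j + gen j * gen i = (if i = j then (-2 : ℝ) else 0) • (1 : Cl n) := by
  rw [gen, gen, CliffordAlgebra.ι_mul_ι_add_swap, ← Algebra.algebraMap_eq_smul_one]
  congr 1
  simp only [QuadraticMap.polar, cliffordForm, QuadraticMap.weightedSumSquares_apply, Pi.add_apply]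
  rw [← Finset.sum_sub_distrib, ← Finset.sum_sub_distrib]
  have : ∀ k, (-1 : ℝ) • (((Pi.single i 1 : Fin n → ℝ) k + (Pi.single j 1 : Fin n → ℝ) k)
      * ((Pi.single i 1 : Fin n → ℝ) k + (Pi.single j 1 : Fin n → ℝ) k))
      - (-1 : ℝ) • ((Pi.single i 1 : Fin n → ℝ) k * (Pi.single i 1 : Fin n → ℝ) k)
      - (-1 : ℝ) • ((Pi.single j 1 : Fin n → ℝ) k * (Pi.single j 1 : Fin n → ℝ) k)
      = if k = i then (if i = j then (-2 : ℝ) else 0) else 0 := by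
    intro k
    simp only [Pi.single_apply, smul_eq_mul]
    split_ifs <;> first | (exfalso; simp_all; done) | norm_num
  rw [Finset.sum_congr rfl fun k _ => this k]
  simp

theorem map_gen_mul_gen_add {n : ℕ} {A : Type*} [Ring A] [Algebra ℝ A] (ρ : Cl n →ₐ[ℝ] A)
    (i j : Fin n) :
    ρ (gen i) * ρ (gen j) + ρ (gen j) * ρ (gen i) = (if i = j then (-2 : ℝ) else 0) • (1 : A) := by
  rw [← map_mul, ← map_mul, ← map_add, gen_mul_gen_add, map_smul, map_one]

/-! ### Smoothness and product rules for endomorphism-valued functions. -/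

section EndValued

variable {n : ℕ} {M : Type*} [TopologicalSpace M] [ChartedSpace (EuclideanSpace ℝ (Fin n)) M]
  [IsManifold (𝓡 n) ∞ M]

theorem mvfderiv_clm_comp {F G : Type*} [NormedAddCommGroup F] [NormedSpace ℝ F]
    [NormedAddCommGroup G] [NormedSpace ℝ G] (l : F →L[ℝ] G) {f : M → F} {x : M}
    (hf : MDifferentiableAt (𝓡 n) 𝓘(ℝ, F) f x) (v : TangentSpace (𝓡 n) x) :
    mvfderiv (𝓡 n) (fun y => l (f y)) x v = l (mvfderiv (𝓡 n) f x v) := by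
  have h := mfderiv_comp_apply (I := 𝓡 n) (I' := 𝓘(ℝ, F)) (I'' := 𝓘(ℝ, G)) x
    (g := l) l.mdifferentiableAt hf v
  rw [l.mfderiv_eq] at h
  exact h

variable {Δ : Type*} [NormedAddCommGroup Δ] [NormedSpace ℂ Δ] [FiniteDimensional ℂ Δ]
  {G K : M → Module.End ℂ Δ} {ψ : M → Δ} {x : M}

variable (n) in
/-- The endomorphism-valued function `G` is smooth at `x`. -/
def SmoothEndAt (G : M → Module.End ℂ Δ) (x : M) : Prop :=
  ∀ w, ContMDiffAt (𝓡 n) 𝓘(ℝ, Δ) ∞ (fun y => G y w) x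

/-- Splits `G y (ψ y)` into scalar functions times `G y` at fixed vectors, the only values about
which `SmoothEndAt` speaks. The basis is real because differentiation is over `ℝ`. -/
theorem end_apply_eq_sum (T : Module.End ℂ Δ) (w : Δ) :
    T w = ∑ i, ((Module.finBasis ℝ Δ).coord i).toContinuousLinearMap w •
      T (Module.finBasis ℝ Δ i) := by
  conv_lhs => rw [← (Module.finBasis ℝ Δ).sum_repr w, map_sum]
  refine Finset.sum_congr rfl fun i _ => ?_
  rw [LinearMap.map_smul_of_tower]
  rfl

theorem SmoothEndAt.apply (hG : SmoothEndAt n G x) (hψ : ContMDiffAt (𝓡 n) 𝓘(ℝ, Δ) ∞ ψ x) :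
    ContMDiffAt (𝓡 n) 𝓘(ℝ, Δ) ∞ (fun y => G y (ψ y)) x := by
  simp_rw [fun y => end_apply_eq_sum (G y) (ψ y)]
  exact contMDiffAt_fun_sum _ fun i _ =>
    ((((Module.finBasis ℝ Δ).coord i).toContinuousLinearMap.contMDiff).contMDiffAt.comp x hψ).smul
      (hG _)

theorem SmoothEndAt.mul (hG : SmoothEndAt n G x) (hK : SmoothEndAt n K x) :
    SmoothEndAt n (fun y => G y * K y) x := fun w => hG.apply (hK w)

theorem SmoothEndAt.add (hG : SmoothEndAt n G x) (hK : SmoothEndAt n K x) :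
    SmoothEndAt n (fun y => G y + K y) x := fun w => (hG w).add (hK w)

theorem smoothEndAt_const (T : Module.End ℂ Δ) : SmoothEndAt n (fun _ : M => T) x :=
  fun _ => contMDiffAt_const

theorem SmoothEndAt.sum {κ : Type*} (s : Finset κ) {G : κ → M → Module.End ℂ Δ}
    (hG : ∀ k ∈ s, SmoothEndAt n (G k) x) : SmoothEndAt n (fun y => ∑ k ∈ s, G k y) x := fun w => by
  simpa only [LinearMap.sum_apply] using contMDiffAt_fun_sum s fun k hk => hG k hk w

theorem SmoothEndAt.smul (hG : SmoothEndAt n G x) {a : M → ℝ}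
    (ha : ContMDiffAt (𝓡 n) 𝓘(ℝ, ℝ) ∞ a x) : SmoothEndAt n (fun y => a y • G y) x :=
  fun w => ContMDiffAt.smul ha (hG w)

theorem SmoothEndAt.csmul (hG : SmoothEndAt n G x) {a : M → ℂ}
    (ha : ContMDiffAt (𝓡 n) 𝓘(ℝ, ℂ) ∞ a x) : SmoothEndAt n (fun y => a y • G y) x := by
  intro w
  -- The complex factor is split as `re + im · I`, with `I` acting as a constant endomorphism, to
  -- stay with real scalar multiplication.
  have h := (((Complex.reCLM.contMDiff.contMDiffAt.comp x ha).smul (hG w))).add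
    ((Complex.imCLM.contMDiff.contMDiffAt.comp x ha).smul
      ((smoothEndAt_const (Complex.I • (1 : Module.End ℂ Δ))).apply (hG w)))
  refine h.congr_of_eventuallyEq (Filter.Eventually.of_forall fun y => ?_)
  change a y • G y w = (a y).re • G y w + (a y).im • Complex.I • G y w
  conv_lhs => rw [← Complex.re_add_im (a y), add_smul, mul_smul]
  simp

/-- The product rule for the action of an endomorphism-valued function. -/
theorem mvfderiv_end_apply (hG : SmoothEndAt n G x) (hψ : MDifferentiableAt (𝓡 n) 𝓘(ℝ, Δ) ψ x)
    (v : TangentSpace (𝓡 n) x) :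
    mvfderiv (𝓡 n) (fun y => G y (ψ y)) x v =
      mvfderiv (𝓡 n) (fun y => G y (ψ x)) x v + G x (mvfderiv (𝓡 n) ψ x v) := by
  have hb : ∀ i, MDifferentiableAt (𝓡 n) 𝓘(ℝ, Δ) (fun y => G y (Module.finBasis ℝ Δ i)) x :=
    fun i => (hG _).mdifferentiableAt (by simp)
  have hl : ∀ i, MDifferentiableAt (𝓡 n) 𝓘(ℝ, ℝ)
      (fun y => ((Module.finBasis ℝ Δ).coord i).toContinuousLinearMap (ψ y)) x :=
    fun i => (ContinuousLinearMap.mdifferentiableAt _).comp x hψ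
  have key := (mvfderiv_fun_sum (n := n) Finset.univ (f := fun i y =>
    ((Module.finBasis ℝ Δ).coord i).toContinuousLinearMap (ψ y) • G y (Module.finBasis ℝ Δ i))
    (x := x) fun i _ => (hl i).smul (hb i)).1
  have key2 := (mvfderiv_fun_sum (n := n) Finset.univ (f := fun i y =>
    ((Module.finBasis ℝ Δ).coord i).toContinuousLinearMap (ψ x) • G y (Module.finBasis ℝ Δ i))
    (x := x) fun i _ => mdifferentiableAt_const.smul (hb i)).1
  have e1 : (fun y => G y (ψ y)) = fun y => ∑ i,
      ((Module.finBasis ℝ Δ).coord i).toContinuousLinearMap (ψ y) • G y (Module.finBasis ℝ Δ i) :=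
    funext fun y => end_apply_eq_sum _ _
  have e2 : (fun y => G y (ψ x)) = fun y => ∑ i,
      ((Module.finBasis ℝ Δ).coord i).toContinuousLinearMap (ψ x) • G y (Module.finBasis ℝ Δ i) :=
    funext fun y => end_apply_eq_sum _ _
  rw [e1, e2, key, key2, end_apply_eq_sum (G x) (mvfderiv (𝓡 n) ψ x v), sum_apply, sum_apply,
    ← Finset.sum_add_distrib]
  refine Finset.sum_congr rfl fun i _ => ?_
  rw [mvfderiv_fun_smul (hl i) (hb i), mvfderiv_fun_smul mdifferentiableAt_const (hb i),
    mvfderiv_const]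
  simp only [add_apply, ContinuousLinearMap.smulRight_apply, mvfderiv_clm_comp _ hψ]
  simp

end EndValued

end DiracWitten

namespace DiracWitten

/-! ### The spin connection, its curvature and the Lichnerowicz formula. -/

section SpinConnection

variable {n : ℕ} {M : Type*} [TopologicalSpace M] [ChartedSpace (EuclideanSpace ℝ (Fin n)) M]
  [IsManifold (𝓡 n) ∞ M] [RiemannianBundle (fun x : M => TangentSpace (𝓡 n) x)]
  [IsContMDiffRiemannianBundle (𝓡 n) ∞ (EuclideanSpace ℝ (Fin n))
    (fun x : M => TangentSpace (𝓡 n) x)]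
  {Δ : Type*} [NormedAddCommGroup Δ] [NormedSpace ℂ Δ]
  (ρ : Cl n →ₐ[ℝ] Module.End ℂ Δ) (e : Fin n → Π x : M, TangentSpace (𝓡 n) x)

/-- The spin connection form as a linear map. -/
noncomputable def spinFormLin (x : M) : TangentSpace (𝓡 n) x →ₗ[ℝ] Module.End ℂ Δ where
  toFun := spinForm ρ e x
  map_add' X Y := by
    simp only [spinForm, connForm, map_add, inner_add_left, add_smul, Finset.sum_add_distrib,
      smul_add]
  map_smul' a X := by
    simp only [spinForm, connForm, map_smul, inner_smul_left, mul_smul, ← Finset.smul_sum]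
    exact smul_comm _ _ _

/-- The connection form of the connection `∇^S_X - ½ (c(X) A + B c(X))` as a linear map. -/
noncomputable def modFormLin (A B : M → Module.End ℂ Δ) (x : M) :
    TangentSpace (𝓡 n) x →ₗ[ℝ] Module.End ℂ Δ where
  toFun X := spinFormLin ρ e x X - (1 / 2 : ℝ) • (cliff ρ e x X * A x + B x * cliff ρ e x X)
  map_add' X Y := by
    have : cliff ρ e x (X + Y) = cliff ρ e x X + cliff ρ e x Y := by
      simp only [cliff, inner_add_left, add_smul, Finset.sum_add_distrib]
    rw [this, map_add, add_mul, mul_add]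
    module
  map_smul' a X := by
    have : cliff ρ e x (a • X) = a • cliff ρ e x X := by
      simp only [cliff, inner_smul_left, mul_smul, ← Finset.smul_sum]
      rfl
    rw [this, map_smul, smul_mul_assoc, mul_smul_comm, RingHom.id_apply]
    module

theorem spinConn_eq_matConn : spinConn ρ e = matConn (spinFormLin ρ e) := rfl

theorem modConn_eq_matConn (A B : M → Module.End ℂ Δ) :
    modConn ρ e A B = matConn (modFormLin ρ e A B) := by
  ext ψ x X
  simp only [modConn, matConn, spinConn, modFormLin, LinearMap.coe_mk, AddHom.coe_mk,
    LinearMap.sub_apply, LinearMap.smul_apply]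
  exact (add_sub_assoc _ _ _)

variable {ρ e} [FiniteDimensional ℂ Δ] {U : Set M} {x : M} {ψ : M → Δ}
  {G K : M → Module.End ℂ Δ}

/-- `endConn` is defined with constant extensions in the spin frame; this shows that it satisfies
the Leibniz rule for every differentiable section. -/
theorem spinConn_end_apply (hG : SmoothEndAt n G x)
    (hψ : MDifferentiableAt (𝓡 n) 𝓘(ℝ, Δ) ψ x) (X : TangentSpace (𝓡 n) x) :
    spinConn ρ e (fun y => G y (ψ y)) x X =
      endConn ρ e G x X (ψ x) + G x (spinConn ρ e ψ x X) := by
  simp only [endConn, spinConn, mvfderiv_end_apply hG hψ, mvfderiv_const, map_add]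
  simp
  abel

theorem endConn_mul (hG : SmoothEndAt n G x) (hK : SmoothEndAt n K x)
    (X : TangentSpace (𝓡 n) x) (w : Δ) :
    endConn ρ e (fun y => G y * K y) x X w =
      endConn ρ e G x X (K x w) + G x (endConn ρ e K x X w) := by
  have := spinConn_end_apply (ρ := ρ) (e := e) hG ((hK w).mdifferentiableAt (by simp)) X
  simp only [endConn, Module.End.mul_apply] at this ⊢
  rw [this, map_sub]
  abel

theorem spinConn_add {χ : M → Δ} (hψ : MDifferentiableAt (𝓡 n) 𝓘(ℝ, Δ) ψ x)
    (hχ : MDifferentiableAt (𝓡 n) 𝓘(ℝ, Δ) χ x) (X : TangentSpace (𝓡 n) x) :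
    spinConn ρ e (fun y => ψ y + χ y) x X = spinConn ρ e ψ x X + spinConn ρ e χ x X := by
  simp only [spinConn, mvfderiv_fun_add hψ hχ, map_add, add_apply]
  abel

theorem spinConn_sum {κ : Type*} (s : Finset κ) {f : κ → M → Δ}
    (hf : ∀ k, MDifferentiableAt (𝓡 n) 𝓘(ℝ, Δ) (f k) x) (X : TangentSpace (𝓡 n) x) :
    spinConn ρ e (fun y => ∑ k ∈ s, f k y) x X = ∑ k ∈ s, spinConn ρ e (f k) x X := by
  simp only [spinConn, (mvfderiv_fun_sum s fun k _ => hf k).1, map_sum, sum_apply,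
    Finset.sum_add_distrib]

theorem endConn_add (hG : SmoothEndAt n G x) (hK : SmoothEndAt n K x)
    (X : TangentSpace (𝓡 n) x) (w : Δ) :
    endConn ρ e (fun y => G y + K y) x X w = endConn ρ e G x X w + endConn ρ e K x X w := by
  have := spinConn_add (ρ := ρ) (e := e) ((hG w).mdifferentiableAt (by simp))
    ((hK w).mdifferentiableAt (by simp)) X
  simp only [endConn, LinearMap.add_apply] at this ⊢
  rw [this]
  abel

/-- The covariant derivative `y ↦ ∇^S_{e_k} ψ`. -/
noncomputable abbrev frameDeriv (ρ : Cl n →ₐ[ℝ] Module.End ℂ Δ)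
    (e : Fin n → Π x : M, TangentSpace (𝓡 n) x) (k : Fin n) (ψ : M → Δ) (y : M) : Δ :=
  spinConn ρ e ψ y (e k y)

namespace IsOrthonormalFrameOn

variable (h : IsOrthonormalFrameOn e U) (hx : x ∈ U)

include h hx

theorem cliff_frame (i : Fin n) : cliff ρ e x (e i x) = ρ (gen i) := by
  simp [cliff, h.inner_eq_ite hx]

/-- Clifford multiplication is parallel: `∇^S c(e_k) = c(∇^L e_k)`. In the spin frame `c(e_k)` is
constant, so only its commutator with the connection form contributes. -/
theorem endConn_gen (k : Fin n) (X : TangentSpace (𝓡 n) x) (w : Δ) :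
    endConn ρ e (fun _ => ρ (gen k)) x X w = ∑ s, connForm e s k x X • ρ (gen s) w := by
  have h1 := congrArg (fun T : Module.End ℂ Δ => T w) (spinMatrix_commutator
    (map_gen_mul_gen_add ρ) (w := fun s t => connForm e s t x X)
    (fun s t => h.connForm_skew hx s t X) k)
  simp only [Module.End.mul_apply, LinearMap.add_apply, LinearMap.sum_apply,
    LinearMap.smul_apply] at h1
  simp only [endConn, spinConn, mvfderiv_const, zero_apply, zero_add]
  change spinMatrix (fun i => ρ (gen i)) (fun s t => connForm e s t x X) (ρ (gen k) w) - _ = _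
  rw [h1]
  exact add_sub_cancel_left _ _

theorem smoothEndAt_spinForm (k : Fin n) :
    SmoothEndAt n (fun y => spinForm ρ e y (e k y)) x := by
  unfold spinForm
  exact (SmoothEndAt.sum _ fun s _ => SmoothEndAt.sum _ fun t _ =>
    (smoothEndAt_const _).smul (h.contMDiffAt_connForm hx (h.smooth k x hx) s t)).smul
      contMDiffAt_const

theorem contMDiffAt_frameDeriv (hψ : ContMDiffAt (𝓡 n) 𝓘(ℝ, Δ) ∞ ψ x) (k : Fin n) :
    ContMDiffAt (𝓡 n) 𝓘(ℝ, Δ) ∞ (frameDeriv ρ e k ψ) x :=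
  (contMDiffAt_mvfderiv_apply hψ (h.smooth k x hx)).add
    ((h.smoothEndAt_spinForm hx k).apply hψ)

/-- The curvature of the spin connection. -/
theorem frameDeriv_commutator (hψ : ContMDiffAt (𝓡 n) 𝓘(ℝ, Δ) ∞ ψ x) (j k : Fin n) :
    frameDeriv ρ e j (frameDeriv ρ e k ψ) x - frameDeriv ρ e k (frameDeriv ρ e j ψ) x
      - spinConn ρ e ψ x (mlieBracket (𝓡 n) (e j) (e k) x)
      = spinMatrix (fun i => ρ (gen i))
        (fun s t => inner ℝ (curvature (e j) (e k) (e t) x) (e s x)) (ψ x) := by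
  have hN := fun k => h.smoothEndAt_spinForm (ρ := ρ) hx k
  have hψ' : MDifferentiableAt (𝓡 n) 𝓘(ℝ, Δ) ψ x := hψ.mdifferentiableAt (by simp)
  have hd : ∀ k, MDifferentiableAt (𝓡 n) 𝓘(ℝ, Δ) (fun y => mvfderiv (𝓡 n) ψ y (e k y)) x :=
    fun k => (contMDiffAt_mvfderiv_apply hψ (h.smooth k x hx)).mdifferentiableAt (by simp)
  -- With `σ` the spin form, the terms `σ(e_k) e_j ψ + σ(e_j) e_k ψ` are symmetric in `j, k` and
  -- drop out of the commutator. The derivatives of `σ`, the bracket term and `[σ(e_j), σ(e_k)]`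
  -- then match the structure equation for the curvature term by term.
  have e1 : ∀ j k, frameDeriv ρ e j (frameDeriv ρ e k ψ) x =
      mvfderiv (𝓡 n) (fun y => mvfderiv (𝓡 n) ψ y (e k y)) x (e j x)
      + (mvfderiv (𝓡 n) (fun y => spinForm ρ e y (e k y) (ψ x)) x (e j x)
        + spinForm ρ e x (e k x) (mvfderiv (𝓡 n) ψ x (e j x)))
      + (spinForm ρ e x (e j x) (mvfderiv (𝓡 n) ψ x (e k x))
        + (spinForm ρ e x (e j x) * spinForm ρ e x (e k x)) (ψ x)) := by
    intro j k
    rw [← mvfderiv_end_apply (hN k) hψ']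
    change mvfderiv (𝓡 n) (fun y => mvfderiv (𝓡 n) ψ y (e k y) + spinForm ρ e y (e k y) (ψ y)) x
      (e j x) + spinForm ρ e x (e j x) (mvfderiv (𝓡 n) ψ x (e k x)
        + spinForm ρ e x (e k x) (ψ x)) = _
    rw [mvfderiv_fun_add (hd k) (((hN k).apply hψ).mdifferentiableAt (by simp))]
    simp only [add_apply, map_add, Module.End.mul_apply]
  have e2 : ∀ j k, mvfderiv (𝓡 n) (fun y => spinForm ρ e y (e k y) (ψ x)) x (e j x) =
      spinMatrix (fun i => ρ (gen i))
        (fun s t => mvfderiv (𝓡 n) (fun y => connForm e s t y (e k y)) x (e j x)) (ψ x) := by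
    intro j k
    have hω : ∀ s t, MDifferentiableAt (𝓡 n) 𝓘(ℝ, ℝ) (fun y => connForm e s t y (e k y)) x :=
      fun s t => (h.contMDiffAt_connForm hx (h.smooth k x hx) s t).mdifferentiableAt (by simp)
    have hs : ∀ s t, MDifferentiableAt (𝓡 n) 𝓘(ℝ, Δ)
        (fun y => connForm e s t y (e k y) • (ρ (gen s) * ρ (gen t)) (ψ x)) x :=
      fun s t => (hω s t).smul mdifferentiableAt_const
    have hss : ∀ s, MDifferentiableAt (𝓡 n) 𝓘(ℝ, Δ)
        (fun y => ∑ t, connForm e s t y (e k y) • (ρ (gen s) * ρ (gen t)) (ψ x)) x :=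
      fun s => (mvfderiv_fun_sum _ fun t _ => hs s t).2
    have hsss := mvfderiv_fun_sum Finset.univ fun s _ => hss s
    simp only [spinForm, LinearMap.smul_apply, LinearMap.sum_apply]
    rw [mvfderiv_fun_smul mdifferentiableAt_const hsss.2, hsss.1, mvfderiv_const]
    simp only [(mvfderiv_fun_sum _ fun t _ => hs _ t).1,
      mvfderiv_fun_smul (hω _ _) mdifferentiableAt_const, mvfderiv_const]
    simp [spinMatrix]
  have e3 := congrArg (fun T : Module.End ℂ Δ => T (ψ x)) (spinMatrix_mul_sub_mul
    (map_gen_mul_gen_add ρ) (w := fun s t => connForm e s t x (e j x))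
    (v := fun s t => connForm e s t x (e k x)) (fun s t => h.connForm_skew hx s t _))
  simp only [LinearMap.sub_apply] at e3
  have e4 := mvfderiv_mlieBracket hψ (h.smooth j x hx) (h.smooth k x hx)
  have e5 : ∀ w₁ w₂ w₃ w₄ : Fin n → Fin n → ℝ,
      spinMatrix (fun i => ρ (gen i)) (fun s t => w₁ s t - w₂ s t - w₃ s t + w₄ s t) (ψ x) =
      spinMatrix (fun i => ρ (gen i)) w₁ (ψ x) - spinMatrix (fun i => ρ (gen i)) w₂ (ψ x)
        - spinMatrix (fun i => ρ (gen i)) w₃ (ψ x) + spinMatrix (fun i => ρ (gen i)) w₄ (ψ x) := by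
    intro w₁ w₂ w₃ w₄
    simp only [← LinearMap.sub_apply, ← LinearMap.add_apply, spinMatrix, add_smul, sub_smul,
      Finset.sum_add_distrib, Finset.sum_sub_distrib, smul_add, smul_sub]
  simp only [h.inner_curvature_frame hx]
  rw [e5, ← e3, e1, e1, e2, e2]
  simp only [spinConn]
  rw [e4]
  change _ = _ - _ - spinForm ρ e x (mlieBracket (𝓡 n) (e j) (e k) x) (ψ x) +
    ((spinForm ρ e x (e j x) * spinForm ρ e x (e k x)) (ψ x)
      - (spinForm ρ e x (e k x) * spinForm ρ e x (e j x)) (ψ x))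
  abel

/-- The Lichnerowicz formula in an orthonormal frame. -/
theorem sum_gen_frameDeriv (hψ : ContMDiffAt (𝓡 n) 𝓘(ℝ, Δ) ∞ ψ x) :
    ∑ j, ∑ k, ρ (gen j) (∑ s, connForm e s k x (e j x) • ρ (gen s) (frameDeriv ρ e k ψ x)
        + ρ (gen k) (frameDeriv ρ e j (frameDeriv ρ e k ψ) x))
      = -∑ k, (frameDeriv ρ e k (frameDeriv ρ e k ψ) x
          - ∑ s, connForm e s k x (e k x) • frameDeriv ρ e s ψ x)
        + (1 / 4 : ℝ) • scalarCurvature e x • ψ x := by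
  set c : Fin n → Module.End ℂ Δ := fun i => ρ (gen i) with hcdef
  have hc : ∀ i j, c i * c j + c j * c i = (if i = j then (-2 : ℝ) else 0) • 1 :=
    map_gen_mul_gen_add ρ
  -- The Hessian of `ψ`. Skewness of `ω` converts the derivative of `c(e_k)` in the left side into
  -- the correction term of `H`, so that side is `∑ c_j c_k H_{jk}` (`e1`).
  set H : Fin n → Fin n → Δ := fun j k => frameDeriv ρ e j (frameDeriv ρ e k ψ) x
    - ∑ s, connForm e s k x (e j x) • frameDeriv ρ e s ψ x with hH
  set R : Fin n → Fin n → Fin n → Fin n → ℝ := fun s t i j =>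
    inner ℝ (curvature (e i) (e j) (e t) x) (e s x) with hR
  have e1 : ∑ j, ∑ k, ρ (gen j) (∑ s, connForm e s k x (e j x) • ρ (gen s) (frameDeriv ρ e k ψ x)
        + ρ (gen k) (frameDeriv ρ e j (frameDeriv ρ e k ψ) x)) = ∑ j, ∑ k, (c j * c k) (H j k) := by
    refine Finset.sum_congr rfl fun j _ => ?_
    have : ∑ k, ∑ s, connForm e s k x (e j x) • c s (frameDeriv ρ e k ψ x) =
        -∑ k, ∑ s, connForm e s k x (e j x) • c k (frameDeriv ρ e s ψ x) := by
      rw [Finset.sum_comm, ← Finset.sum_neg_distrib]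
      refine Finset.sum_congr rfl fun k _ => ?_
      rw [← Finset.sum_neg_distrib]
      exact Finset.sum_congr rfl fun s _ => by rw [h.connForm_skew hx k s, neg_smul]
    simp only [hH, Module.End.mul_apply, map_sub, Finset.sum_sub_distrib, map_sum,
      Finset.sum_add_distrib, map_add, LinearMap.map_smul_of_tower]
    have := congrArg (c j) this
    simp only [map_neg, map_sum, LinearMap.map_smul_of_tower] at this
    rw [this]
    simp only [hcdef]
    abel
  have e2 : ∀ j k, H j k - H k j = spinMatrix c (fun s t => R s t j k) (ψ x) := by
    intro j k
    rw [← h.frameDeriv_commutator hx hψ j k, h.mlieBracket_frame hx, spinConn_eq_matConn,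
      matConn_sum]
    simp only [hH, sub_smul, Finset.sum_sub_distrib, frameDeriv, spinConn_eq_matConn]
    abel
  -- The symmetric part of `H` meets the anticommutator and gives minus the trace; the antisymmetric
  -- part is the spin curvature by `e2`.
  have e3 : (2 : ℝ) • ∑ j, ∑ k, (c j * c k) (H j k) =
      (-2 : ℝ) • ∑ k, H k k + ∑ j, ∑ k, (c j * c k) (H j k - H k j) := by
    have : ∑ j, ∑ k, (c j * c k) (H j k) + ∑ j, ∑ k, (c j * c k) (H k j) =
        (-2 : ℝ) • ∑ k, H k k := by
      nth_rw 2 [Finset.sum_comm]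
      simp only [← Finset.sum_add_distrib, ← LinearMap.add_apply, hc]
      rw [Finset.smul_sum]
      refine Finset.sum_congr rfl fun j _ => ?_
      rw [Finset.sum_eq_single j (fun k _ hk => by simp [Ne.symm hk]) (by simp)]
      simp
    rw [← this]
    simp only [map_sub, Finset.sum_sub_distrib]
    module
  -- The coefficient `½` is the `-¼` of the spin representation times the `-2` of the quartic
  -- Clifford contraction.
  have e4 : ∑ j, ∑ k, (c j * c k) (H j k - H k j) = (1 / 2 : ℝ) • scalarCurvature e x • ψ x := by
    have h1 := congrArg (fun T : Module.End ℂ Δ => T (ψ x)) (sum_curvature_clifford hc (R := R)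
      (fun s t i j => h.inner_curvature_skew_right hx i j s t)
      (fun s t i j => inner_curvature_skew_left e x i j s t)
      (fun s t i j => by
        have := h.curvature_bianchi hx (h.smooth i x hx) (h.smooth j x hx) (h.smooth t x hx)
        simp only [hR, ← inner_add_left]
        rw [this, inner_zero_left]))
    simp only [LinearMap.sum_apply, LinearMap.smul_apply, Module.End.one_apply] at h1
    have h2 : ∑ j, ∑ k, (c j * c k) (H j k - H k j) = (-(1 / 4) : ℝ) •
        ∑ i, ∑ j, ∑ s, ∑ t, R s t i j • (c i * c j * c s * c t) (ψ x) := by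
      simp only [e2, spinMatrix, Finset.smul_sum]
      refine Finset.sum_congr rfl fun i _ => Finset.sum_congr rfl fun j _ => ?_
      simp only [LinearMap.sum_apply, map_sum, LinearMap.smul_apply, LinearMap.map_smul_of_tower,
        Module.End.mul_apply]
    rw [h2, h1, scalarCurvature]
    module
  rw [e1]
  have h5 : (2 : ℝ) • (∑ j, ∑ k, (c j * c k) (H j k) - (-∑ k, H k k
      + (1 / 4 : ℝ) • scalarCurvature e x • ψ x)) = 0 := by
    rw [smul_sub, e3, e4]
    module
  rw [smul_eq_zero_iff_right (by norm_num)] at h5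
  exact sub_eq_zero.1 h5

end IsOrthonormalFrameOn

end SpinConnection

end DiracWitten

namespace DiracWitten

/-! ### The Weitzenböck formula for `(D + B)(D + A)`. -/

section Composition

variable {n : ℕ} {M : Type*} [TopologicalSpace M] [ChartedSpace (EuclideanSpace ℝ (Fin n)) M]
  [IsManifold (𝓡 n) ∞ M] [RiemannianBundle (fun x : M => TangentSpace (𝓡 n) x)]
  [IsContMDiffRiemannianBundle (𝓡 n) ∞ (EuclideanSpace ℝ (Fin n))
    (fun x : M => TangentSpace (𝓡 n) x)]
  {Δ : Type*} [NormedAddCommGroup Δ] [NormedSpace ℂ Δ] [FiniteDimensional ℂ Δ]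
  {ρ : Cl n →ₐ[ℝ] Module.End ℂ Δ} {e : Fin n → Π x : M, TangentSpace (𝓡 n) x}
  {U : Set M} {x : M} {ψ : M → Δ} {A B : M → Module.End ℂ Δ}

theorem spinConn_sub {χ : M → Δ} (hψ : MDifferentiableAt (𝓡 n) 𝓘(ℝ, Δ) ψ x)
    (hχ : MDifferentiableAt (𝓡 n) 𝓘(ℝ, Δ) χ x) (X : TangentSpace (𝓡 n) x) :
    spinConn ρ e (fun y => ψ y - χ y) x X = spinConn ρ e ψ x X - spinConn ρ e χ x X := by
  simp only [spinConn, mvfderiv_fun_sub hψ hχ, map_sub, sub_apply]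
  abel

theorem spinConn_const_smul (a : ℝ) (hψ : MDifferentiableAt (𝓡 n) 𝓘(ℝ, Δ) ψ x)
    (X : TangentSpace (𝓡 n) x) :
    spinConn ρ e (fun y => a • ψ y) x X = a • spinConn ρ e ψ x X := by
  simp [spinConn, mvfderiv_fun_smul mdifferentiableAt_const hψ, mvfderiv_const]

namespace IsOrthonormalFrameOn

variable (h : IsOrthonormalFrameOn e U) (hx : x ∈ U)

include h hx

theorem frameDeriv_gen_apply (hψ : MDifferentiableAt (𝓡 n) 𝓘(ℝ, Δ) ψ x) (j k : Fin n) :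
    frameDeriv ρ e j (fun y => ρ (gen k) (ψ y)) x =
      ∑ s, connForm e s k x (e j x) • ρ (gen s) (ψ x) + ρ (gen k) (frameDeriv ρ e j ψ x) := by
  rw [← h.endConn_gen hx]
  exact spinConn_end_apply (smoothEndAt_const (ρ (gen k))) hψ _

/-- The leading part of the composition of two zeroth order perturbations of the Dirac operator. -/
theorem dirac_dirac_add (hA : SmoothEndAt n A x) (hψ : ContMDiffAt (𝓡 n) 𝓘(ℝ, Δ) ∞ ψ x) :
    dirac ρ e (fun y => dirac ρ e ψ y + A y (ψ y)) x =
      ∑ j, ∑ k, ρ (gen j) (∑ s, connForm e s k x (e j x) • ρ (gen s) (frameDeriv ρ e k ψ x)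
        + ρ (gen k) (frameDeriv ρ e j (frameDeriv ρ e k ψ) x))
      + ∑ j, ρ (gen j) (endConn ρ e A x (e j x) (ψ x))
      + ∑ j, ρ (gen j) (A x (frameDeriv ρ e j ψ x)) := by
  have hT : ∀ k, MDifferentiableAt (𝓡 n) 𝓘(ℝ, Δ) (frameDeriv ρ e k ψ) x := fun k =>
    (h.contMDiffAt_frameDeriv hx hψ k).mdifferentiableAt (by simp)
  have hcT : ∀ k, MDifferentiableAt (𝓡 n) 𝓘(ℝ, Δ)
      (fun y => ρ (gen k) (frameDeriv ρ e k ψ y)) x := fun k =>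
    ((smoothEndAt_const (ρ (gen k))).apply (h.contMDiffAt_frameDeriv hx hψ k)).mdifferentiableAt
      (by simp)
  have key : ∀ j, spinConn ρ e (fun y => dirac ρ e ψ y + A y (ψ y)) x (e j x) =
      ∑ k, (∑ s, connForm e s k x (e j x) • ρ (gen s) (frameDeriv ρ e k ψ x)
        + ρ (gen k) (frameDeriv ρ e j (frameDeriv ρ e k ψ) x))
      + (endConn ρ e A x (e j x) (ψ x) + A x (frameDeriv ρ e j ψ x)) := by
    intro j
    have hD : MDifferentiableAt (𝓡 n) 𝓘(ℝ, Δ) (dirac ρ e ψ) x :=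
      (mvfderiv_fun_sum Finset.univ fun k _ => hcT k).2
    rw [spinConn_add hD ((hA.apply hψ).mdifferentiableAt (by simp)),
      spinConn_end_apply hA (hψ.mdifferentiableAt (by simp))]
    congr 1
    refine (spinConn_sum Finset.univ hcT (e j x)).trans ?_
    exact Finset.sum_congr rfl fun k _ => h.frameDeriv_gen_apply hx (hT k) j k
  rw [dirac]
  simp only [key, map_add, map_sum, Finset.sum_add_distrib]
  abel

/-- The connection Laplacian of the modified connection. -/
theorem connLaplacian_modConn {φ : OpenPartialHomeomorph M (EuclideanSpace ℝ (Fin n))}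
    (hφ : φ ∈ IsManifold.maximalAtlas (𝓡 n) ∞ M) (hxφ : x ∈ φ.source)
    (hA : SmoothEndAt n A x) (hB : SmoothEndAt n B x) (hψ : ContMDiffAt (𝓡 n) 𝓘(ℝ, Δ) ∞ ψ x) :
    connLaplacian (modConn ρ e A B) φ ψ x =
      ∑ k, (frameDeriv ρ e k (frameDeriv ρ e k ψ) x
          - ∑ s, connForm e s k x (e k x) • frameDeriv ρ e s ψ x)
      - ∑ k, (ρ (gen k) * A x + B x * ρ (gen k)) (frameDeriv ρ e k ψ x)
      + (1 / 4 : ℝ) • ∑ k, ((ρ (gen k) * A x + B x * ρ (gen k)) ^ 2) (ψ x)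
      - (1 / 2 : ℝ) • ∑ k, (ρ (gen k) (endConn ρ e A x (e k x) (ψ x))
          + endConn ρ e B x (e k x) (ρ (gen k) (ψ x))) := by
  set W : Fin n → M → Module.End ℂ Δ := fun k y => ρ (gen k) * A y + B y * ρ (gen k) with hW
  have hWs : ∀ k, SmoothEndAt n (W k) x := fun k =>
    ((smoothEndAt_const (ρ (gen k))).mul hA).add (hB.mul (smoothEndAt_const (ρ (gen k))))
  have hψ' : MDifferentiableAt (𝓡 n) 𝓘(ℝ, Δ) ψ x := hψ.mdifferentiableAt (by simp)
  -- `c(e_k)` is the constant `ρ(ε_k)` only where the frame is orthonormal, hence the restriction to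
  -- `U`.
  have hmod : ∀ (χ : M → Δ) k, ∀ y ∈ U, modConn ρ e A B χ y (e k y) =
      frameDeriv ρ e k χ y - (1 / 2 : ℝ) • W k y (χ y) := by
    intro χ k y hy
    rw [modConn, h.cliff_frame hy]
  have hev : ∀ k, (fun y => modConn ρ e A B ψ y (e k y)) =ᶠ[𝓝 x]
      fun y => frameDeriv ρ e k ψ y - (1 / 2 : ℝ) • W k y (ψ y) := by
    intro k
    filter_upwards [h.isOpen.mem_nhds hx] with y hy using hmod ψ k y hy
  have hWψ : ∀ k, MDifferentiableAt (𝓡 n) 𝓘(ℝ, Δ) (fun y => W k y (ψ y)) x :=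
    fun k => ((hWs k).apply hψ).mdifferentiableAt (by simp)
  have hWψ' : ∀ k, MDifferentiableAt (𝓡 n) 𝓘(ℝ, Δ) (fun y => (1 / 2 : ℝ) • W k y (ψ y)) x :=
    fun k => mdifferentiableAt_const.smul (hWψ k)
  have hT : ∀ k, MDifferentiableAt (𝓡 n) 𝓘(ℝ, Δ) (frameDeriv ρ e k ψ) x := fun k =>
    (h.contMDiffAt_frameDeriv hx hψ k).mdifferentiableAt (by simp)
  have hTW : ∀ k, MDifferentiableAt (𝓡 n) 𝓘(ℝ, Δ)
      (fun y => modConn ρ e A B ψ y (e k y)) x := fun k =>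
    ((hT k).sub (hWψ' k)).congr_of_eventuallyEq (hev k)
  -- Since `c(e_k)` is differentiated as well, an `ω`-term in the `W s` appears. It cancels against
  -- the zeroth order part of `∇_{∇^L_{e_k} e_k} ψ`, computed in `h1` below, so no connection forms
  -- survive beside the derivatives of `A` and `B`.
  have hendW : ∀ k, endConn ρ e (W k) x (e k x) (ψ x) =
      ∑ s, connForm e s k x (e k x) • W s x (ψ x) + (ρ (gen k) (endConn ρ e A x (e k x) (ψ x))
          + endConn ρ e B x (e k x) (ρ (gen k) (ψ x))) := by
    intro k
    rw [hW, endConn_add ((smoothEndAt_const (ρ (gen k))).mul hA)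
      (hB.mul (smoothEndAt_const (ρ (gen k)))), endConn_mul (smoothEndAt_const _) hA,
      endConn_mul hB (smoothEndAt_const _), h.endConn_gen hx, h.endConn_gen hx, map_sum]
    simp only [LinearMap.add_apply, Module.End.mul_apply, smul_add, Finset.sum_add_distrib,
      LinearMap.map_smul_of_tower]
    abel
  have hterm : ∀ k, modConn ρ e A B (fun y => modConn ρ e A B ψ y (e k y)) x (e k x)
        - modConn ρ e A B ψ x (leviCivita (𝓡 n) M (e k) x (e k x)) =
      (frameDeriv ρ e k (frameDeriv ρ e k ψ) x
          - ∑ s, connForm e s k x (e k x) • frameDeriv ρ e s ψ x)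
      - W k x (frameDeriv ρ e k ψ x) + (1 / 4 : ℝ) • (W k x ^ 2) (ψ x)
      - (1 / 2 : ℝ) • (ρ (gen k) (endConn ρ e A x (e k x) (ψ x))
          + endConn ρ e B x (e k x) (ρ (gen k) (ψ x))) := by
    intro k
    have h1 : modConn ρ e A B ψ x (leviCivita (𝓡 n) M (e k) x (e k x)) =
        ∑ s, connForm e s k x (e k x) • frameDeriv ρ e s ψ x
          - (1 / 2 : ℝ) • ∑ s, connForm e s k x (e k x) • W s x (ψ x) := by
      rw [h.leviCivita_frame hx, modConn_eq_matConn, matConn_sum, ← modConn_eq_matConn]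
      simp only [hmod ψ _ x hx, smul_sub, Finset.sum_sub_distrib, Finset.smul_sum]
      congr 1
      exact Finset.sum_congr rfl fun s _ => smul_comm _ _ _
    have h2 : modConn ρ e A B (fun y => modConn ρ e A B ψ y (e k y)) x (e k x) =
        frameDeriv ρ e k (fun y => frameDeriv ρ e k ψ y - (1 / 2 : ℝ) • W k y (ψ y)) x
          - (1 / 2 : ℝ) • W k x (frameDeriv ρ e k ψ x - (1 / 2 : ℝ) • W k x (ψ x)) := by
      have h4 := congrFun (matConn_congr (modFormLin ρ e A B) (hev k)) (e k x)
      rw [← modConn_eq_matConn] at h4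
      rw [h4, hmod _ k x hx]
    have h3 : frameDeriv ρ e k (fun y => frameDeriv ρ e k ψ y - (1 / 2 : ℝ) • W k y (ψ y)) x =
        frameDeriv ρ e k (frameDeriv ρ e k ψ) x
          - (1 / 2 : ℝ) • (endConn ρ e (W k) x (e k x) (ψ x) + W k x (frameDeriv ρ e k ψ x)) := by
      rw [← spinConn_end_apply (hWs k) hψ', ← spinConn_const_smul _ (hWψ k)]
      exact spinConn_sub (hT k) (hWψ' k) (e k x)
    rw [h2, h3, h1, hendW, map_sub, LinearMap.map_smul_of_tower, pow_two, Module.End.mul_apply]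
    module
  have hlap := h.connLaplacian_matConn hx hφ hxφ (modFormLin ρ e A B) (ψ := ψ)
    (by rw [← modConn_eq_matConn]; exact hTW)
  rw [← modConn_eq_matConn] at hlap
  rw [hlap]
  simp only [hterm, Finset.sum_add_distrib, Finset.sum_sub_distrib, Finset.smul_sum, smul_add]
  rfl

/-- The Weitzenböck formula for the product `(D + B)(D + A)`. -/
theorem dirac_add_comp_dirac_add {φ : OpenPartialHomeomorph M (EuclideanSpace ℝ (Fin n))}
    (hφ : φ ∈ IsManifold.maximalAtlas (𝓡 n) ∞ M) (hxφ : x ∈ φ.source)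
    (hA : SmoothEndAt n A x) (hB : SmoothEndAt n B x) (hψ : ContMDiffAt (𝓡 n) 𝓘(ℝ, Δ) ∞ ψ x) :
    dirac ρ e (fun y => dirac ρ e ψ y + A y (ψ y)) x + B x (dirac ρ e ψ x + A x (ψ x)) =
      -connLaplacian (modConn ρ e A B) φ ψ x + (1 / 4 : ℝ) • scalarCurvature e x • ψ x
      + (1 / 4 : ℝ) • ∑ i, ((ρ (gen i) * A x + B x * ρ (gen i)) ^ 2) (ψ x)
      + (1 / 2 : ℝ) • ∑ j, (ρ (gen j) (endConn ρ e A x (e j x) (ψ x))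
            - endConn ρ e B x (e j x) (ρ (gen j) (ψ x)))
      + B x (A x (ψ x)) := by
  -- First order terms: `c_k A ∇_k + B c_k ∇_k` is exactly what minus the modified Laplacian
  -- supplies. Zeroth order terms: `c_j (∇_j A) - ½ (c_j (∇_j A) + (∇_j B) c_j)` is the half
  -- difference in the statement.
  rw [h.dirac_dirac_add hx hA hψ, h.sum_gen_frameDeriv hx hψ,
    h.connLaplacian_modConn hx hφ hxφ hA hB hψ]
  simp only [dirac, map_add, map_sum, LinearMap.add_apply, Module.End.mul_apply,
    Finset.sum_add_distrib, Finset.sum_sub_distrib]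
  module

end IsOrthonormalFrameOn

end Composition

end DiracWitten

namespace DiracWitten

/-! ### Smoothness of the zeroth order terms. -/

section SkewTerm

variable {n : ℕ} {M : Type*} [TopologicalSpace M] [ChartedSpace (EuclideanSpace ℝ (Fin n)) M]
  [IsManifold (𝓡 n) ∞ M] [RiemannianBundle (fun x : M => TangentSpace (𝓡 n) x)]
  [IsContMDiffRiemannianBundle (𝓡 n) ∞ (EuclideanSpace ℝ (Fin n))
    (fun x : M => TangentSpace (𝓡 n) x)]
  {Δ : Type*} [NormedAddCommGroup Δ] [NormedSpace ℂ Δ] [FiniteDimensional ℂ Δ]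
  {ρ : Cl n →ₐ[ℝ] Module.End ℂ Δ} {e : Fin n → Π x : M, TangentSpace (𝓡 n) x}
  {U : Set M} {x : M} {p : Π x : M, TangentSpace (𝓡 n) x →L[ℝ] TangentSpace (𝓡 n) x →L[ℝ] ℝ}

theorem SpinStructure.isOrthonormalFrameOn {ι : Type*} (S : SpinStructure n M ι) (α : ι) :
    IsOrthonormalFrameOn (S.frame α) (S.U α) where
  isOpen := S.isOpen_U α
  smooth i _ hx := (S.smooth_frame α i).contMDiffAt ((S.isOpen_U α).mem_nhds hx)
  orthonormal := S.orthonormal_frame α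

theorem contMDiffAt_bilin_apply {X Y : Π x : M, TangentSpace (𝓡 n) x}
    (hp : ContMDiffAt (𝓡 n) ((𝓡 n).prod
        𝓘(ℝ, EuclideanSpace ℝ (Fin n) →L[ℝ] EuclideanSpace ℝ (Fin n) →L[ℝ] ℝ)) ∞
      (fun x => TotalSpace.mk' (EuclideanSpace ℝ (Fin n) →L[ℝ] EuclideanSpace ℝ (Fin n) →L[ℝ] ℝ)
        (E := fun x : M => TangentSpace (𝓡 n) x →L[ℝ] TangentSpace (𝓡 n) x →L[ℝ] ℝ) x (p x)) x)
    (hX : SmoothFieldAt X x) (hY : SmoothFieldAt Y x) :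
    ContMDiffAt (𝓡 n) 𝓘(ℝ, ℝ) ∞ (fun y => p y (X y) (Y y)) x := by
  have h := ContMDiffAt.clm_bundle_apply₂ (F₁ := EuclideanSpace ℝ (Fin n))
    (F₂ := EuclideanSpace ℝ (Fin n)) (F₃ := ℝ) (E₁ := fun x : M => TangentSpace (𝓡 n) x)
    (E₂ := fun x : M => TangentSpace (𝓡 n) x) (E₃ := Bundle.Trivial M ℝ)
    (b := fun y : M => y) (ψ := p) (v := X) (w := Y) hp hX hY
  simpa using (contMDiffAt_section x).1 h

theorem IsOrthonormalFrameOn.smoothEndAt_skewTerm (h : IsOrthonormalFrameOn e U) (hx : x ∈ U)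
    (hp : ContMDiffAt (𝓡 n) ((𝓡 n).prod
        𝓘(ℝ, EuclideanSpace ℝ (Fin n) →L[ℝ] EuclideanSpace ℝ (Fin n) →L[ℝ] ℝ)) ∞
      (fun x => TotalSpace.mk' (EuclideanSpace ℝ (Fin n) →L[ℝ] EuclideanSpace ℝ (Fin n) →L[ℝ] ℝ)
        (E := fun x : M => TangentSpace (𝓡 n) x →L[ℝ] TangentSpace (𝓡 n) x →L[ℝ] ℝ) x (p x)) x) :
    SmoothEndAt n (skewTerm ρ e p) x :=
  SmoothEndAt.sum _ fun u _ => SmoothEndAt.sum _ fun v _ =>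
    (smoothEndAt_const (ρ (gen u) * ρ (gen v))).smul
      ((contMDiffAt_bilin_apply hp (h.smooth u x hx) (h.smooth v x hx)).sub
        (contMDiffAt_bilin_apply hp (h.smooth v x hx) (h.smooth u x hx)))

theorem SmoothEndAt.smul_add_smul_one {P : M → Module.End ℂ Δ} (hP : SmoothEndAt n P x)
    {f g : M → ℂ} (hf : ContMDiffAt (𝓡 n) 𝓘(ℝ, ℂ) ∞ f x) (hg : ContMDiffAt (𝓡 n) 𝓘(ℝ, ℂ) ∞ g x) :
    SmoothEndAt n (fun y => f y • P y + g y • 1) x :=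
  (hP.csmul hf).add ((smoothEndAt_const 1).csmul hg)

theorem contMDiffAt_conj {f : M → ℂ} (hf : ContMDiffAt (𝓡 n) 𝓘(ℝ, ℂ) ∞ f x) :
    ContMDiffAt (𝓡 n) 𝓘(ℝ, ℂ) ∞ (fun y => starRingEnd ℂ (f y)) x :=
  Complex.conjCLE.toContinuousLinearMap.contMDiff.contMDiffAt.comp x hf

end SkewTerm

end DiracWitten
-- The two Lichnerowicz type formulas.
theorem theorem2p1 {n : ℕ} (hn : 3 ≤ n)
    {M : Type*} [TopologicalSpace M] [T2Space M] [CompactSpace M]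
    [ChartedSpace (EuclideanSpace ℝ (Fin n)) M] [IsManifold (𝓡 n) ∞ M]
    [RiemannianBundle (fun x : M => TangentSpace (𝓡 n) x)]
    [IsContMDiffRiemannianBundle (𝓡 n) ∞ (EuclideanSpace ℝ (Fin n))
      (fun x : M => TangentSpace (𝓡 n) x)]
    {ι : Type*} (S : SpinStructure n M ι)
    {Δ : Type*} [NormedAddCommGroup Δ] [NormedSpace ℂ Δ] [FiniteDimensional ℂ Δ]
    (ρ : Cl n →ₐ[ℝ] Module.End ℂ Δ)
    (p : Π x : M, TangentSpace (𝓡 n) x →L[ℝ] TangentSpace (𝓡 n) x →L[ℝ] ℝ)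
    (hp : ContMDiff (𝓡 n) ((𝓡 n).prod
        𝓘(ℝ, EuclideanSpace ℝ (Fin n) →L[ℝ] EuclideanSpace ℝ (Fin n) →L[ℝ] ℝ)) ∞
      (fun x => TotalSpace.mk' (EuclideanSpace ℝ (Fin n) →L[ℝ] EuclideanSpace ℝ (Fin n) →L[ℝ] ℝ)
        (E := fun x : M => TangentSpace (𝓡 n) x →L[ℝ] TangentSpace (𝓡 n) x →L[ℝ] ℝ) x (p x)))
    (f₁ f₂ : M → ℂ) (hf₁ : ContMDiff (𝓡 n) 𝓘(ℝ, ℂ) ∞ f₁) (hf₂ : ContMDiff (𝓡 n) 𝓘(ℝ, ℂ) ∞ f₂)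
    (Ψ : SpinorField S ρ) (α : ι)
    (φ : OpenPartialHomeomorph M (EuclideanSpace ℝ (Fin n)))
    (hφ : φ ∈ IsManifold.maximalAtlas (𝓡 n) ∞ M)
    (x : M) (hxα : x ∈ S.U α) (hxφ : x ∈ φ.source) :
    let e := S.frame α
    let ψ := Ψ.comp α
    let c : Fin n → Module.End ℂ Δ := fun i => ρ (gen i)
    let P : M → Module.End ℂ Δ := skewTerm ρ e p
    let A : M → Module.End ℂ Δ := fun y => f₁ y • P y + f₂ y • 1
    let B : M → Module.End ℂ Δ := fun y => -starRingEnd ℂ (f₁ y) • P y + starRingEnd ℂ (f₂ y) • 1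
    (diracWittenAdj ρ e p f₁ f₂ (diracWitten ρ e p f₁ f₂ ψ) x =
      -connLaplacian (modConn ρ e A B) φ ψ x
        + (1 / 4 : ℝ) • scalarCurvature e x • ψ x
        + (f₁ x * starRingEnd ℂ (f₂ x) - starRingEnd ℂ (f₁ x) * f₂ x) • P x (ψ x)
        + (1 / 4 : ℝ) • ∑ i, ((c i * A x + B x * c i) ^ 2) (ψ x)
        + (1 / 2 : ℝ) • ∑ j, (c j (endConn ρ e A x (e j x) (ψ x))
            - endConn ρ e B x (e j x) (c j (ψ x)))
        - (f₁ x * starRingEnd ℂ (f₁ x)) • (P x ^ 2) (ψ x)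
        + (f₂ x * starRingEnd ℂ (f₂ x)) • ψ x) ∧
    (diracWitten ρ e p f₁ f₂ (diracWitten ρ e p f₁ f₂ ψ) x =
      -connLaplacian (modConn ρ e A A) φ ψ x
        + (1 / 4 : ℝ) • scalarCurvature e x • ψ x
        + f₁ x ^ 2 • (P x ^ 2) (ψ x)
        + (1 / 4 : ℝ) • ∑ i, ((c i * A x + A x * c i) ^ 2) (ψ x)
        - (1 / 2 : ℝ) • ∑ j, (endConn ρ e A x (e j x) (c j (ψ x))
            - c j (endConn ρ e A x (e j x) (ψ x)))
        + (2 * f₁ x * f₂ x) • P x (ψ x)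
        + f₂ x ^ 2 • ψ x) := by
  intro e ψ c P A B
  have h := S.isOrthonormalFrameOn α
  have hP : SmoothEndAt n P x := h.smoothEndAt_skewTerm hxα hp.contMDiffAt
  have hA : SmoothEndAt n A x := hP.smul_add_smul_one hf₁.contMDiffAt hf₂.contMDiffAt
  have hB : SmoothEndAt n B x := hP.smul_add_smul_one (contMDiffAt_conj hf₁.contMDiffAt).neg
    (contMDiffAt_conj hf₂.contMDiffAt)
  have hψ : ContMDiffAt (𝓡 n) 𝓘(ℝ, Δ) ∞ ψ x :=
    (Ψ.smooth_comp α).contMDiffAt ((S.isOpen_U α).mem_nhds hxα)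
  -- An equality of functions, since the inner operator's output is differentiated; for the outer
  -- adjoint the value at `x` suffices.
  have hD : ∀ χ : M → Δ, diracWitten ρ e p f₁ f₂ χ = fun y => dirac ρ e χ y + A y (χ y) := by
    intro χ
    funext y
    simp only [diracWitten, A, P, LinearMap.add_apply, LinearMap.smul_apply, Module.End.one_apply,
      add_assoc]
  have hD' : ∀ χ : M → Δ, diracWittenAdj ρ e p f₁ f₂ χ x = dirac ρ e χ x + B x (χ x) := by
    intro χ
    simp only [diracWittenAdj, B, P, LinearMap.add_apply, LinearMap.smul_apply,
      Module.End.one_apply, neg_smul, LinearMap.neg_apply]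
    abel
  constructor
  · rw [hD', hD]
    refine (h.dirac_add_comp_dirac_add hxα hφ hxφ hA hB hψ).trans ?_
    -- The product `(-f̄₁ P + f̄₂)(f₁ P + f₂)` supplies all the terms in which `P` and the `fᵢ`
    -- appear explicitly.
    have hBA : B x (A x (ψ x)) =
        (f₁ x * starRingEnd ℂ (f₂ x) - starRingEnd ℂ (f₁ x) * f₂ x) • P x (ψ x)
        - (f₁ x * starRingEnd ℂ (f₁ x)) • (P x ^ 2) (ψ x)
        + (f₂ x * starRingEnd ℂ (f₂ x)) • ψ x := by
      simp only [A, B, LinearMap.add_apply, LinearMap.smul_apply, Module.End.one_apply, map_add,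
        map_smul, pow_two, Module.End.mul_apply]
      module
    rw [hBA]
    abel
  · rw [hD, hD]
    refine (h.dirac_add_comp_dirac_add hxα hφ hxφ hA hA hψ).trans ?_
    have hAA : A x (A x (ψ x)) = f₁ x ^ 2 • (P x ^ 2) (ψ x)
        + (2 * f₁ x * f₂ x) • P x (ψ x) + f₂ x ^ 2 • ψ x := by
      simp only [A, LinearMap.add_apply, LinearMap.smul_apply, Module.End.one_apply, map_add,
        map_smul, pow_two, Module.End.mul_apply]
      module
    -- The second formula is written with the opposite order in the difference, hence the sign.
    have hneg : ∑ j, (c j (endConn ρ e A x (e j x) (ψ x)) - endConn ρ e A x (e j x) (c j (ψ x))) =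
        -∑ j, (endConn ρ e A x (e j x) (c j (ψ x)) - c j (endConn ρ e A x (e j x) (ψ x))) := by
      rw [← Finset.sum_neg_distrib]
      exact Finset.sum_congr rfl fun j _ => (neg_sub _ _).symm
    rw [hAA, hneg, smul_neg]
    abel
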